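/- **Notation.** Let $n\ge 1$. A partition $\kappa=(\kappa_1\ge\dots\ge\kappa_n\ge 0)$ has weight $|\kappa|=\sum_i\kappa_i$, length $\ell(\kappa)$ (its number of non-zero parts) and conjugate $\kappa'$. Let $m_\kappa$ be the monomial symmetric polynomial in $x_1,\dots,x_n$, and let $<$ denote the strict dominance order on partitions of equal weight. For $\alpha>0$ the Jack polynomial $P^{(\alpha)}_\kappa$ is the unique symmetric polynomial in $x_1,\dots,x_n$ of the form $m_\kappa+\sum_{\mu<\kappa}c_{\kappa\mu}m_\mu$ that is an eigenfunction of $$\sum_{i}x_i^2\frac{\partial^2}{\partial x_i^2}+\frac2\alpha\sum_{i\ne j}\frac{x_i^2}{x_i-x_j}\frac{\partial}{\partial x_i}-\frac{2}{\alpha}(n-1)\sum_i x_i\frac{\partial}{\partial x_i}.$$ Put $(z)_k=z(z+1)\cdots(z+k-1)$, $[z]^{(\alpha)}_\kappa=\prod_{i}\big(z-\tfrac{i-1}{\alpha}\big)_{\kappa_i}$ and $h^{(\alpha)}_\kappa=\prod_{(i,j)\in\kappa}\big(1+(\kappa_i-j)+\tfrac1\alpha(\kappa'_j-i)\big)$,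 and define $${}_p\mathcal F^{(\alpha)}_q(a;b;x;y)=\sum_{k\ge 0}\ \sum_{\ell(\kappa)\le n,\,|\kappa|=k}\frac1{h^{(\alpha)}_\kappa}\frac{[a_1]^{(\alpha)}_\kappa\cdots[a_p]^{(\alpha)}_\kappa}{[b_1]^{(\alpha)}_\kappa\cdots[b_q]^{(\alpha)}_\kappa}\frac{P^{(\alpha)}_\kappa(x)P^{(\alpha)}_\kappa(y)}{P^{(\alpha)}_\kappa(1,\dots,1)},$$ $${}_pF^{(\alpha)}_q(a;b;x)=\sum_{k\ge 0}\ \sum_{\ell(\kappa)\le n,\,|\kappa|=k}\frac1{h^{(\alpha)}_\kappa}\frac{[a_1]^{(\alpha)}_\kappa\cdots[a_p]^{(\alpha)}_\kappa}{[b_1]^{(\alpha)}_\kappa\cdots[b_q]^{(\alpha)}_\kappa}P^{(\alpha)}_\kappa(x),\qquad {}_pf_q(z)=\sum_{k\ge0}\frac{(a_1)_k\cdots(a_p)_k}{(b_1)_k\cdots(b_q)_k}\frac{z^k}{k!}.$$ **Proposition (closed form for $\alpha=1$).** Let $p,q\ge 0$ be integers, let $a_1,\dots,a_p\in\mathbb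 C$ with $a_r\notin\{0,-1,\dots,-(n-2)\}$, and let $b_1,\dots,b_q\in\mathbb C$ with $b_s\notin\{0,-1,-2,\dots\}$. Write $a+n-1=(a_1+n-1,\dots,a_p+n-1)$, and similarly $b+n-1$. (i) Let $x\in\mathbb C^n$ and $y\in\mathbb C^n$ each have pairwise distinct coordinates. Suppose that $p\le q$, or that $p=q+1$ and $|x_jy_k|<1$ for all $j,k$, or that some $a_r$ is a non-positive integer. Then the series ${}_p\mathcal F^{(1)}_q(a+n-1;b+n-1;x;y)$ converges absolutely and $${}_p\mathcal F^{(1)}_q(a+n-1;b+n-1;x;y)=\prod_{i=0}^{n-1}\frac{i!\,(b_1)_i\cdots(b_q)_i}{(a_1)_i\cdots(a_p)_i}\;\frac{\det[{}_pf_q(x_jy_k)]_{j,k=1}^n}{\det[x_j^{k-1}]_{j,k=1}^n\,\det[y_j^{k-1}]_{j,k=1}^n}.$$ (ii) Let $x\in\mathbb C^n$ have pairwise distinct coordinates. Suppose that $p\le q$, or that $p=q+1$ and $|x_j|<1$ for all $j$, or that some $a_r$ is a non-positive integer. Then the series ${}_pF^{(1)}_q(a+n-1;b+n-1;x)$ converges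 absolutely and $${}_pF^{(1)}_q(a+n-1;b+n-1;x)=\prod_{i=0}^{n-1}\frac{(b_1)_i\cdots(b_q)_i}{(a_1)_i\cdots(a_p)_i}\;\frac{\det[x_j^{k-1}\,{}_pf_q^{(k-1)}(x_j)]_{j,k=1}^n}{\det[x_j^{k-1}]_{j,k=1}^n},$$ where ${}_pf_q^{(k-1)}$ is the derivative of order $k-1$. -/

import Mathlib

open scoped Nat

noncomputable section

namespace JackHyp

/-! A partition `κ` with at most `n` non-zero parts is an antitone function `Fin n → ℕ`, the part
`κ_{i+1}` being the value at `i`. -/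

/-- The partitions of weight `k` with at most `n` non-zero parts. -/
def partitions (n k : ℕ) : Finset (Fin n → ℕ) :=
  open Classical in (Finset.piAntidiag Finset.univ k).filter (fun κ => Antitone κ)

/-- The strict dominance order `μ < κ` on partitions (of the same weight). -/
def DomLT {n : ℕ} (μ κ : Fin n → ℕ) : Prop :=
  ∑ i, μ i = ∑ i, κ i ∧ μ ≠ κ ∧
    ∀ k : Fin n, ∑ i ∈ Finset.Iic k, μ i ≤ ∑ i ∈ Finset.Iic k, κ i

/-- The monomial symmetric polynomial `m_κ`: the sum of the monomials whose exponents are the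
distinct permutations of `κ`. -/
def monomialSymm {n : ℕ} (κ : Fin n → ℕ) : MvPolynomial (Fin n) ℂ :=
  ∑ μ ∈ Finset.univ.image (fun σ : Equiv.Perm (Fin n) => κ ∘ σ), ∏ i, MvPolynomial.X i ^ μ i

/-- The operator `E_k = ∑ x_i^k ∂_i`, applied to `P` and evaluated at `x`. -/
def opE {n : ℕ} (k : ℕ) (P : MvPolynomial (Fin n) ℂ) (x : Fin n → ℂ) : ℂ :=
  ∑ i, x i ^ k * MvPolynomial.eval x (MvPolynomial.pderiv i P)

/-- The operator `D_k = ∑ x_i^k ∂_i² + (2/α) ∑_{i ≠ j} x_i^k / (x_i - x_j) ∂_i`, applied to `P`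
and evaluated at a point `x` with pairwise distinct coordinates. -/
def opD {n : ℕ} (α : ℝ) (k : ℕ) (P : MvPolynomial (Fin n) ℂ) (x : Fin n → ℂ) : ℂ :=
  ∑ i, x i ^ k * MvPolynomial.eval x (MvPolynomial.pderiv i (MvPolynomial.pderiv i P)) +
    2 / (α : ℂ) * ∑ i, ∑ j ∈ Finset.univ.erase i,
      x i ^ k / (x i - x j) * MvPolynomial.eval x (MvPolynomial.pderiv i P)

/-- `P` is a Jack polynomial of parameter `α` for the partition `κ`: it is symmetric, equals
`m_κ` plus a combination of the `m_μ` with `μ < κ`, and is an eigenfunction of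
`D_2 - (2/α)(n-1) E_1` (an identity of rational functions, hence tested at all points with
pairwise distinct coordinates). -/
structure IsJack {n : ℕ} (α : ℝ) (κ : Fin n → ℕ) (P : MvPolynomial (Fin n) ℂ) : Prop where
  symmetric : P.IsSymmetric
  triangular : P - monomialSymm κ ∈
    Submodule.span ℂ (monomialSymm '' {μ : Fin n → ℕ | Antitone μ ∧ DomLT μ κ})
  eigen : ∃ ε : ℂ, ∀ x : Fin n → ℂ, Function.Injective x →
    opD α 2 P x - 2 / (α : ℂ) * ((n : ℂ) - 1) * opE 1 P x = ε * MvPolynomial.eval x P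

/-- The Jack polynomial `P_κ^{(α)}` in `n` variables (for `α > 0` there is exactly one). -/
def jack {n : ℕ} (α : ℝ) (κ : Fin n → ℕ) : MvPolynomial (Fin n) ℂ :=
  open Classical in if h : ∃ P, IsJack α κ P then h.choose else 0

/-- The part `κ'_{j+1}` of the conjugate partition. -/
def conjPart {n : ℕ} (κ : Fin n → ℕ) (j : ℕ) : ℕ :=
  (Finset.univ.filter (fun i => j < κ i)).card

/-- The hook length `h_κ^{(α)} = ∏ (1 + a_κ(i,j) + l_κ(i,j)/α)`, with arm
`a_κ(i,j) = κ_i - j` and leg `l_κ(i,j) = κ'_j - i` (here `i`, `j` are counted from zero). -/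
def hook {n : ℕ} (α : ℝ) (κ : Fin n → ℕ) : ℂ :=
  ∏ i : Fin n, ∏ j ∈ Finset.range (κ i),
    (1 + ((κ i : ℂ) - ((j : ℂ) + 1)) +
      1 / (α : ℂ) * ((conjPart κ j : ℂ) - (((i : ℕ) : ℂ) + 1)))

/-- The Pochhammer symbol `(z)_k = z (z+1) ⋯ (z+k-1)`. -/
def poch (z : ℂ) (k : ℕ) : ℂ := (ascPochhammer ℂ k).eval z

/-- The deformed Pochhammer symbol `[z]_κ^{(α)} = ∏_i (z - (i-1)/α)_{κ_i}`. -/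
def jackPoch {n : ℕ} (α : ℝ) (z : ℂ) (κ : Fin n → ℕ) : ℂ :=
  ∏ i : Fin n, poch (z - ((i : ℕ) : ℂ) / (α : ℂ)) (κ i)

/-- The coefficient `(1/h_κ) [a_1]_κ ⋯ [a_p]_κ / ([b_1]_κ ⋯ [b_q]_κ)`. -/
def coeff {n p q : ℕ} (α : ℝ) (a : Fin p → ℂ) (b : Fin q → ℂ) (κ : Fin n → ℕ) : ℂ :=
  1 / hook α κ * ((∏ r, jackPoch α (a r) κ) / ∏ s, jackPoch α (b s) κ)

/-- The `κ`-term of the series in two sets of variables. -/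
def term₂ {n p q : ℕ} (α : ℝ) (a : Fin p → ℂ) (b : Fin q → ℂ) (x y : Fin n → ℂ)
    (κ : Fin n → ℕ) : ℂ :=
  coeff α a b κ * (MvPolynomial.eval x (jack α κ) * MvPolynomial.eval y (jack α κ) /
    MvPolynomial.eval (fun _ => 1) (jack α κ))

/-- The `κ`-term of the series in one set of variables. -/
def term₁ {n p q : ℕ} (α : ℝ) (a : Fin p → ℂ) (b : Fin q → ℂ) (x : Fin n → ℂ)
    (κ : Fin n → ℕ) : ℂ :=
  coeff α a b κ * MvPolynomial.eval x (jack α κ)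

/-- The hypergeometric series `ₚ𝓕_q^{(α)}(a; b; x; y)`. -/
def hyp₂ {n p q : ℕ} (α : ℝ) (a : Fin p → ℂ) (b : Fin q → ℂ) (x y : Fin n → ℂ) : ℂ :=
  ∑' k : ℕ, ∑ κ ∈ partitions n k, term₂ α a b x y κ

/-- The hypergeometric series `ₚF_q^{(α)}(a; b; x)`. -/
def hyp₁ {n p q : ℕ} (α : ℝ) (a : Fin p → ℂ) (b : Fin q → ℂ) (x : Fin n → ℂ) : ℂ :=
  ∑' k : ℕ, ∑ κ ∈ partitions n k, term₁ α a b x κ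

/-- The classical series `ₚf_q(z) = ∑_k (a_1)_k ⋯ (a_p)_k / ((b_1)_k ⋯ (b_q)_k) z^k / k!`. -/
def pfq {p q : ℕ} (a : Fin p → ℂ) (b : Fin q → ℂ) (z : ℂ) : ℂ :=
  ∑' k : ℕ, (∏ r, poch (a r) k) / (∏ s, poch (b s) k) * (z ^ k / (k ! : ℂ))

end JackHyp

end

/-! At `α = 1` the logarithmic derivative of the Vandermonde determinant Δ supplies exactly the
first-order part of the Jack operator. Conjugation by Δ therefore turns that operator, up to a
constant, into one that is diagonal on monomials, with eigenvalue Σ e_i² - (2n-1) Σ e_i. Along the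
dominance order this eigenvalue is strictly monotone on the exponents e_i = κ_{n-i} + i. With
unitriangularity it forces Δ · P_κ to be the alternant det(x_j^{e_k}), so P_κ is a Schur polynomial
(`vandermondePoly_mul_jack`).

In terms of e every ingredient factors: h_κ ∏_{i<j}(e_j - e_i) = ∏ e_i! (`hook_mul_diffProd`),
P_κ(1,…,1) = ∏_{i<j}(e_j - e_i) / ∏ i! (`diffProd_mul_eval_one_jack`), and [z+n-1]_κ = ∏ (z)_{e_i} /
∏ (z)_i (`jackPoch_mul_prod`). With c_k the coefficients of the classical series, each term is a
constant times det(c_{e_i} x_j^{e_i}) · det(y_l^{e_i}). In one set of variables the second factor is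
instead the difference product, written as a determinant of falling factorials.

As κ varies, e runs over all strictly increasing sequences. The Cauchy–Binet formula for series
(`summable_and_det_tsum_eq_tsum_strictMono`) then sums the terms to one determinant of one-variable
series, and absolute convergence reduces to that of those series. -/

noncomputable section
namespace JackHyp
open MvPolynomial

/-! ### Partitions and strictly increasing exponents -/

/-- The strictly increasing sequence of exponents `κ_{n-i} + i` attached to a partition. -/
def shifted {n : ℕ} (κ : Fin n → ℕ) (i : Fin n) : ℕ := κ (Fin.rev i) + i

lemma shifted_strictMono {n : ℕ} {κ : Fin n → ℕ} (hκ : Antitone κ) : StrictMono (shifted κ) := by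
  intro i j hij
  have h := hκ (Fin.rev_le_rev.mpr hij.le)
  have h' : (i : ℕ) < j := hij
  simp only [shifted]
  omega

lemma shifted_injective {n : ℕ} : Function.Injective (shifted (n := n)) := by
  intro κ μ h
  funext i
  have h' := congrFun h (Fin.rev i)
  simpa [shifted] using h'

lemma add_sub_le_of_strictMono {n : ℕ} {e : Fin n → ℕ} (he : StrictMono e) {i j : Fin n}
    (hij : i ≤ j) : e i + (j - i : ℕ) ≤ e j := by
  obtain ⟨i, hi⟩ := i
  obtain ⟨j, hj⟩ := j
  have hij' : i ≤ j := hij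
  clear hij
  induction j, hij' using Nat.le_induction with
  | base => simp
  | succ k hk ih =>
    have h1 := ih (by omega)
    have h2 : e ⟨k, by omega⟩ < e ⟨k + 1, hj⟩ := he (by simp [Fin.lt_def])
    simp only at h1 ⊢
    omega

lemma exists_shifted_eq {n : ℕ} {e : Fin n → ℕ} (he : StrictMono e) :
    ∃ κ : Fin n → ℕ, Antitone κ ∧ shifted κ = e := by
  have hle : ∀ i : Fin n, (i : ℕ) ≤ e i := by
    intro i
    have h := add_sub_le_of_strictMono he (i := ⟨0, i.pos⟩) (j := i) (by simp [Fin.le_def])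
    simp only at h
    omega
  -- The truncated subtraction is exact because i ≤ e_i.
  refine ⟨fun i => e (Fin.rev i) - (Fin.rev i : ℕ), ?_, ?_⟩
  · intro i j hij
    have h := add_sub_le_of_strictMono he (Fin.rev_le_rev.mpr hij)
    have h1 := hle (Fin.rev j)
    have h2 : (Fin.rev j : ℕ) ≤ Fin.rev i := Fin.rev_le_rev.mpr hij
    simp only at h ⊢
    omega
  · funext i
    have := hle i
    simp only [shifted, Fin.rev_rev]
    omega

/-- Partitions with at most `n` parts correspond to strictly increasing sequences of length `n`. -/
def shiftedEquiv (n : ℕ) : {κ : Fin n → ℕ // Antitone κ} ≃ {e : Fin n → ℕ // StrictMono e} :=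
  Equiv.ofBijective (fun κ => ⟨shifted κ.1, shifted_strictMono κ.2⟩)
    ⟨fun κ μ h => Subtype.ext (shifted_injective (Subtype.ext_iff.mp h)),
      fun e => by
        obtain ⟨κ, hκ, h⟩ := exists_shifted_eq e.2
        exact ⟨⟨κ, hκ⟩, Subtype.ext h⟩⟩

/-! ### Inequalities for the dominance order. -/

/-- Rearrangement inequality against the indicator of an initial segment. -/
lemma sum_Iic_comp_perm_le {n : ℕ} {f : Fin n → ℕ} (hf : Antitone f)
    (π : Equiv.Perm (Fin n)) (k : Fin n) :
    ∑ i ∈ Finset.Iic k, f (π i) ≤ ∑ i ∈ Finset.Iic k, f i := by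
  have hg : Antitone (fun i : Fin n => if i ≤ k then (1 : ℕ) else 0) := by
    intro i j hij
    by_cases hj : j ≤ k
    · simp [hj, hij.trans hj]
    · simp [hj]
  have h := (hf.monovary hg).sum_comp_perm_mul_le_sum_mul (σ := π)
  have hs : ∀ F : Fin n → ℕ, ∑ i, F i * (if i ≤ k then (1 : ℕ) else 0) =
      ∑ i ∈ Finset.Iic k, F i := by
    intro F
    rw [← Finset.sum_filter_add_sum_filter_not Finset.univ (fun i => i ≤ k)]
    have : Finset.univ.filter (fun i : Fin n => i ≤ k) = Finset.Iic k := by ext; simp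
    rw [this]
    rw [Finset.sum_congr rfl (g := F) (by intro i hi; simp [Finset.mem_Iic.mp hi])]
    rw [add_eq_left]
    apply Finset.sum_eq_zero
    intro i hi
    simp only [Finset.mem_filter] at hi
    simp [hi.2]
  simpa only [hs] using h

/-- Abel summation: an antitone weight pairs non-negatively with a sequence of non-negative
partial sums and zero total. -/
lemma sum_mul_nonneg_of_antitone {n : ℕ} (d e : Fin n → ℤ) (he : Antitone e)
    (hd : ∀ k : Fin n, 0 ≤ ∑ i ∈ Finset.Iic k, d i) (h0 : ∑ i, d i = 0) :
    0 ≤ ∑ i, d i * e i := by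
  -- The induction needs non-negative weights in place of a zero total: the last weight is
  -- subtracted from all the others and multiplies the full sum of d.
  have key : ∀ m : ℕ, ∀ d e : Fin m → ℤ, Antitone e → (∀ i, 0 ≤ e i) →
      (∀ k : Fin m, 0 ≤ ∑ i ∈ Finset.Iic k, d i) → 0 ≤ ∑ i, d i * e i := by
    intro m
    induction m with
    | zero => intros; simp
    | succ m ih =>
      intro d e he hpos hd
      have h1 := ih (fun i => d i.castSucc) (fun i => e i.castSucc - e (Fin.last m))
        (fun i j hij => sub_le_sub_right (he (Fin.castSucc_le_castSucc_iff.mpr hij)) _)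
        (fun i => sub_nonneg.mpr (he (Fin.le_last _)))
        (fun k => by
          have := hd k.castSucc
          rwa [← Fin.map_castSuccEmb_Iic, Finset.sum_map] at this)
      have h2 : 0 ≤ ∑ i, d i := by
        have := hd (Fin.last m)
        rwa [show Finset.Iic (Fin.last m) = Finset.univ from by ext; simp [Fin.le_last]] at this
      have h3 := mul_nonneg h2 (hpos (Fin.last m))
      rw [Fin.sum_univ_castSucc] at h3 ⊢
      simp only [mul_sub, Finset.sum_sub_distrib, ← Finset.sum_mul] at h1
      linarith
  rcases n with _ | n
  · simp
  have h1 := key _ d (fun i => e i - e (Fin.last n)) (fun i j hij => sub_le_sub_right (he hij) _)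
    (fun i => sub_nonneg.mpr (he (Fin.le_last _))) hd
  simpa [mul_sub, Finset.sum_sub_distrib, ← Finset.sum_mul, h0] using h1

lemma sum_shifted {n : ℕ} {κ μ : Fin n → ℕ} (h : ∑ i, μ i = ∑ i, κ i) :
    ∑ i, shifted μ i = ∑ i, shifted κ i := by
  simp only [shifted, Finset.sum_add_distrib]
  have hrev : ∀ ρ : Fin n → ℕ, ∑ i, ρ (Fin.rev i) = ∑ i, ρ i := Equiv.sum_comp Fin.revPerm
  rw [hrev, hrev, h]

/-- With d = κ - μ and e the reversed shifted μ, the difference of the two sides is Σ d² + 2 Σ d e,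
whose second sum is non-negative by Abel summation. This quantity serves as induction measure and
separates the eigenvalues. -/
lemma sum_sq_shifted_lt {n : ℕ} {κ μ : Fin n → ℕ} (hμ : Antitone μ) (h : DomLT μ κ) :
    ∑ i, shifted μ i ^ 2 < ∑ i, shifted κ i ^ 2 := by
  obtain ⟨hsum, hne, hpart⟩ := h
  set d : Fin n → ℤ := fun i => (κ i : ℤ) - μ i with hd
  set e : Fin n → ℤ := fun i => (μ i : ℤ) + (Fin.rev i : ℕ) with he
  have hnn := sum_mul_nonneg_of_antitone d e
    (by
      intro i j hij
      have h1 := hμ hij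
      have h2 : (Fin.rev j : ℕ) ≤ Fin.rev i := Fin.rev_le_rev.mpr hij
      simp only [he]
      omega)
    (by
      intro k
      have := hpart k
      simp only [hd, Finset.sum_sub_distrib]
      zify at this
      linarith)
    (by
      simp only [hd, Finset.sum_sub_distrib]
      zify at hsum
      linarith)
  have hpos : 0 < ∑ i, d i ^ 2 := by
    obtain ⟨i, hi⟩ := Function.ne_iff.mp hne
    refine Finset.sum_pos' (fun i _ => sq_nonneg _) ⟨i, Finset.mem_univ _, ?_⟩
    have : d i ≠ 0 := by simp only [hd]; omega
    positivity
  have e1 : ∀ ρ : Fin n → ℕ, ((∑ i, shifted ρ i ^ 2 : ℕ) : ℤ) =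
      ∑ i, ((ρ i : ℤ) + (Fin.rev i : ℕ)) ^ 2 := by
    intro ρ
    rw [← Equiv.sum_comp Fin.revPerm]
    push_cast [shifted]
    simp
  zify
  have e2 := e1 κ
  have e3 := e1 μ
  push_cast at e2 e3
  rw [e2, e3, ← sub_pos, ← Finset.sum_sub_distrib]
  have : ∑ i, (((κ i : ℤ) + (Fin.rev i : ℕ)) ^ 2 - ((μ i : ℤ) + (Fin.rev i : ℕ)) ^ 2) =
      ∑ i, d i ^ 2 + 2 * ∑ i, d i * e i := by
    rw [Finset.mul_sum, ← Finset.sum_add_distrib]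
    refine Finset.sum_congr rfl fun i _ => ?_
    simp only [hd, he]
    ring
  rw [this]
  linarith

lemma DomLT.trans {n : ℕ} {κ μ ν : Fin n → ℕ} (hν : Antitone ν) (hμ : Antitone μ)
    (h₁ : DomLT ν μ) (h₂ : DomLT μ κ) : DomLT ν κ := by
  refine ⟨h₁.1.trans h₂.1, ?_, fun k => (h₁.2.2 k).trans (h₂.2.2 k)⟩
  rintro rfl
  exact absurd (sum_sq_shifted_lt hν h₁) (not_lt.mpr (sum_sq_shifted_lt hμ h₂).le)

/-! ### Alternants -/

/-- The alternant `det (x_j ^ e_k)`. -/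
def alternant {n : ℕ} (e : Fin n → ℕ) : MvPolynomial (Fin n) ℂ :=
  (Matrix.of fun j k : Fin n => (X j : MvPolynomial (Fin n) ℂ) ^ e k).det

/-- The Vandermonde determinant `det (x_j ^ k)`. -/
def vandermondePoly (n : ℕ) : MvPolynomial (Fin n) ℂ := alternant (fun i : Fin n => (i : ℕ))

lemma alternant_eq_sum {n : ℕ} (e : Fin n → ℕ) :
    alternant e = ∑ σ : Equiv.Perm (Fin n), ((Equiv.Perm.sign σ : ℤ) : MvPolynomial (Fin n) ℂ) *
      ∏ i, X i ^ e (σ i) := by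
  rw [alternant, ← Matrix.det_transpose, Matrix.det_apply']
  simp

lemma eval_alternant {n : ℕ} (e : Fin n → ℕ) (x : Fin n → ℂ) :
    eval x (alternant e) = (Matrix.of fun j k : Fin n => x j ^ e k).det := by
  rw [alternant, RingHom.map_det]
  congr 1
  ext i j
  simp

lemma alternant_comp_perm {n : ℕ} (e : Fin n → ℕ) (τ : Equiv.Perm (Fin n)) :
    alternant (e ∘ τ) = ((Equiv.Perm.sign τ : ℤ) : MvPolynomial (Fin n) ℂ) * alternant e :=
  Matrix.det_permute' τ (Matrix.of fun j k : Fin n => (X j : MvPolynomial (Fin n) ℂ) ^ e k)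

lemma alternant_eq_zero {n : ℕ} {e : Fin n → ℕ} (he : ¬ Function.Injective e) :
    alternant e = 0 := by
  simp only [Function.Injective, not_forall] at he
  obtain ⟨i, j, hij, hne⟩ := he
  exact Matrix.det_zero_of_column_eq hne (fun k => by simp [hij])

lemma prod_X_pow_eq_monomial {n : ℕ} (γ : Fin n → ℕ) :
    (∏ i, X i ^ γ i : MvPolynomial (Fin n) ℂ) = monomial (Finsupp.equivFunOnFinite.symm γ) 1 := by
  rw [monomial_eq, Finsupp.prod_fintype _ _ (by simp)]
  simp

lemma coeff_alternant {n : ℕ} (e : Fin n → ℕ) (s : Fin n →₀ ℕ) :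
    MvPolynomial.coeff s (alternant e) =
      ∑ σ : Equiv.Perm (Fin n), if e ∘ σ = s then ((Equiv.Perm.sign σ : ℤ) : ℂ) else 0 := by
  rw [alternant_eq_sum, coeff_sum]
  refine Finset.sum_congr rfl fun σ _ => ?_
  rw [prod_X_pow_eq_monomial, ← map_intCast (C (σ := Fin n) (R := ℂ)), coeff_C_mul,
    coeff_monomial]
  have h : (Finsupp.equivFunOnFinite.symm (fun i => e (σ i)) = s) ↔ e ∘ σ = s := by
    rw [Equiv.symm_apply_eq]
    rfl
  simp [h]

lemma coeff_alternant_self {n : ℕ} {e : Fin n → ℕ} (he : Function.Injective e)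
    {s : Fin n →₀ ℕ} (hs : e = s) : MvPolynomial.coeff s (alternant e) = 1 := by
  rw [coeff_alternant, Finset.sum_eq_single 1]
  · simp [hs]
  · intro σ _ hσ
    rw [if_neg]
    intro h
    apply hσ
    ext i : 1
    exact he (congrFun (h.trans hs.symm) i)
  · simp

/-- The orbit of κ is stable under permutations, so for each σ in the expansion of the Vandermonde
determinant the sum over the orbit can be reindexed by σ. -/
lemma vandermondePoly_mul_monomialSymm {n : ℕ} (κ : Fin n → ℕ) :
    vandermondePoly n * monomialSymm κ =
      ∑ ν ∈ Finset.univ.image (fun σ : Equiv.Perm (Fin n) => κ ∘ σ),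
        alternant (fun i => (i : ℕ) + ν i) := by
  simp only [vandermondePoly, monomialSymm, alternant_eq_sum, Finset.sum_mul]
  rw [Finset.sum_comm (s := Finset.univ.image (fun σ : Equiv.Perm (Fin n) => κ ∘ σ))]
  refine Finset.sum_congr rfl fun σ _ => ?_
  simp only [pow_add, Finset.prod_mul_distrib, Finset.mul_sum, mul_assoc]
  refine Finset.sum_nbij' (fun ν => ν ∘ σ.symm) (fun ν => ν ∘ σ) ?_ ?_ ?_ ?_ ?_
  · simp only [Finset.mem_image, Finset.mem_univ, true_and, forall_exists_index,
      forall_apply_eq_imp_iff]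
    exact fun τ => ⟨σ.symm.trans τ, by ext; simp⟩
  · simp only [Finset.mem_image, Finset.mem_univ, true_and, forall_exists_index,
      forall_apply_eq_imp_iff]
    exact fun τ => ⟨σ.trans τ, by ext; simp⟩
  · intro ν _; ext; simp
  · intro ν _; ext; simp
  · intro ν _; simp

lemma exists_perm_strictMono {n : ℕ} {e : Fin n → ℕ} (he : Function.Injective e) :
    ∃ τ : Equiv.Perm (Fin n), StrictMono (e ∘ τ) :=
  ⟨Tuple.sort e, (Tuple.monotone_sort e).strictMono_of_injective
    (he.comp (Tuple.sort e).injective)⟩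

/-- Sorting the exponents `i + ν_i`, where `ν` rearranges `κ`, yields a partition dominated
by `κ`. -/
lemma domLT_of_shifted_eq {n : ℕ} {κ μ : Fin n → ℕ} (hκ : Antitone κ)
    {σ τ : Equiv.Perm (Fin n)} (hne : κ ∘ σ ≠ κ ∘ Fin.rev)
    (h : shifted μ = (fun i : Fin n => (i : ℕ) + κ (σ i)) ∘ τ) : DomLT μ κ := by
  -- Read backwards, μ + (n-1, …, 0) is a rearrangement of (n-1, …, 0) plus a rearrangement of κ;
  -- each has partial sums at most those of its antitone order.
  have hi : ∀ i, μ i + (Fin.rev i : ℕ) =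
      (Fin.rev (Fin.revPerm.trans (τ.trans Fin.revPerm) i) : ℕ) +
        κ (Fin.revPerm.trans (τ.trans σ) i) := by
    intro i
    have := congrFun h (Fin.rev i)
    simpa [shifted] using this
  have hrevanti : Antitone (fun i : Fin n => (Fin.rev i : ℕ)) :=
    fun i j hij => Fin.rev_le_rev.mpr hij
  have hdom : ∀ k : Fin n, ∑ i ∈ Finset.Iic k, μ i ≤ ∑ i ∈ Finset.Iic k, κ i := by
    intro k
    have h1 := sum_Iic_comp_perm_le hrevanti (Fin.revPerm.trans (τ.trans Fin.revPerm)) k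
    have h2 := sum_Iic_comp_perm_le hκ (Fin.revPerm.trans (τ.trans σ)) k
    have h3 := Finset.sum_congr (rfl : Finset.Iic k = Finset.Iic k) (fun i _ => hi i)
    rw [Finset.sum_add_distrib, Finset.sum_add_distrib] at h3
    omega
  have hsum : ∑ i, μ i = ∑ i, κ i := by
    have h3 := Finset.sum_congr (rfl : (Finset.univ : Finset (Fin n)) = _) (fun i _ => hi i)
    rw [Finset.sum_add_distrib, Finset.sum_add_distrib,
      Equiv.sum_comp _ (fun i : Fin n => (Fin.rev i : ℕ)), Equiv.sum_comp _ κ] at h3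
    omega
  refine ⟨hsum, ?_, hdom⟩
  rintro rfl
  apply hne
  -- If μ = κ, comparing sums of squares gives equality in the rearrangement inequality for Σ i κ(σ
  -- i). Then κ ∘ σ is monotone, hence equal to κ ∘ rev, which `hne` excludes.
  have hsq : ∑ i, shifted μ i ^ 2 = ∑ i : Fin n, ((i : ℕ) + μ (σ i)) ^ 2 := by
    rw [h]
    exact Equiv.sum_comp τ (fun i : Fin n => ((i : ℕ) + μ (σ i)) ^ 2)
  have hmono : Monotone (fun i : Fin n => μ (Fin.rev i)) :=
    fun i j hij => hκ (Fin.rev_le_rev.mpr hij)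
  have hvary : Monovary (fun i : Fin n => (i : ℕ)) (fun i : Fin n => μ (Fin.rev i)) :=
    Monotone.monovary (fun i j hij => hij) hmono
  have hcomp : ∀ i, μ (σ i) = μ (Fin.rev ((σ.trans Fin.revPerm) i)) := by simp
  have hexp : ∀ ν : Fin n → ℕ, ∑ i : Fin n, ((i : ℕ) + ν i) ^ 2 =
      ∑ i : Fin n, (i : ℕ) ^ 2 + 2 * ∑ i : Fin n, (i : ℕ) * ν i + ∑ i, ν i ^ 2 := by
    intro ν
    rw [Finset.mul_sum, ← Finset.sum_add_distrib, ← Finset.sum_add_distrib]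
    exact Finset.sum_congr rfl fun i _ => by ring
  have heq : ∑ i : Fin n, (i : ℕ) * μ (Fin.rev ((σ.trans Fin.revPerm) i)) =
      ∑ i : Fin n, (i : ℕ) * μ (Fin.rev i) := by
    have h1 := hexp (fun i => μ (σ i))
    have h2 := hexp (fun i => μ (Fin.rev i))
    have h3 : ∑ i, μ (σ i) ^ 2 = ∑ i, μ i ^ 2 := Equiv.sum_comp σ (fun i => μ i ^ 2)
    have h4 : ∑ i, μ (Fin.rev i) ^ 2 = ∑ i, μ i ^ 2 :=
      Equiv.sum_comp Fin.revPerm (fun i => μ i ^ 2)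
    have h5 : ∑ i, shifted μ i ^ 2 = ∑ i : Fin n, ((i : ℕ) + μ (Fin.rev i)) ^ 2 :=
      Finset.sum_congr rfl fun i _ => by rw [shifted, add_comm]
    simp only [← hcomp]
    omega
  have hv := (hvary.sum_mul_comp_perm_eq_sum_mul_iff (σ := σ.trans Fin.revPerm)).mp heq
  have hm : Monotone (fun i => μ (σ i)) := by
    intro i j hij
    by_contra! hlt
    have := hv (i := j) (j := i) (by simpa using hlt)
    have hji : j ≤ i := this
    rw [le_antisymm hij hji] at hlt
    exact lt_irrefl _ hlt
  exact Tuple.unique_monotone (f := μ) (σ := σ) (τ := Fin.revPerm) hm hmono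

/-- The product of the Vandermonde determinant and `m_κ` is unitriangular in alternants. -/
lemma vandermondePoly_mul_monomialSymm_sub_mem {n : ℕ} {κ : Fin n → ℕ} (hκ : Antitone κ) :
    vandermondePoly n * monomialSymm κ - alternant (shifted κ) ∈
      Submodule.span ℂ ((fun μ => alternant (shifted μ)) ''
        {μ : Fin n → ℕ | Antitone μ ∧ DomLT μ κ}) := by
  have hmem : κ ∘ Fin.rev ∈ Finset.univ.image (fun σ : Equiv.Perm (Fin n) => κ ∘ σ) :=
    Finset.mem_image.mpr ⟨Fin.revPerm, Finset.mem_univ _, by ext; simp⟩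
  have hs : alternant (shifted κ) = alternant (fun i => (i : ℕ) + (κ ∘ Fin.rev) i) := by
    congr 1; funext i; simp [shifted, add_comm]
  rw [vandermondePoly_mul_monomialSymm, ← Finset.add_sum_erase _ _ hmem, hs, add_sub_cancel_left]
  refine Submodule.sum_mem _ fun ν hν => ?_
  rw [Finset.mem_erase, Finset.mem_image] at hν
  obtain ⟨hne, σ, -, rfl⟩ := hν
  -- Distinct exponents are sorted at the cost of a sign; a repeated exponent kills the alternant.
  by_cases hinj : Function.Injective (fun i : Fin n => (i : ℕ) + (κ ∘ σ) i)
  · obtain ⟨τ, hτ⟩ := exists_perm_strictMono hinj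
    obtain ⟨μ, hμ, hμe⟩ := exists_shifted_eq hτ
    have hdom := domLT_of_shifted_eq hκ hne hμe
    have h1 := alternant_comp_perm (fun i : Fin n => (i : ℕ) + (κ ∘ σ) i) τ
    have h2 : alternant (fun i : Fin n => (i : ℕ) + (κ ∘ σ) i) =
        ((Equiv.Perm.sign τ : ℤ) : ℂ) • alternant (shifted μ) := by
      rw [hμe, h1, smul_eq_C_mul, map_intCast, ← mul_assoc, ← Int.cast_mul, ← Units.val_mul,
        Int.units_mul_self]
      simp
    rw [h2]
    exact Submodule.smul_mem _ _ (Submodule.subset_span ⟨μ, ⟨hμ, hdom⟩, rfl⟩)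
  · rw [alternant_eq_zero hinj]
    exact Submodule.zero_mem _

/-- The Schur polynomial: the quotient of an alternant by the Vandermonde determinant, with its
expansion in monomial symmetric polynomials. -/
lemma exists_vandermondePoly_mul_eq_alternant {n : ℕ} (κ : Fin n → ℕ) (hκ : Antitone κ) :
    ∃ P : MvPolynomial (Fin n) ℂ, vandermondePoly n * P = alternant (shifted κ) ∧
      P - monomialSymm κ ∈
        Submodule.span ℂ (monomialSymm '' {μ : Fin n → ℕ | Antitone μ ∧ DomLT μ κ}) := by
  -- The unitriangular system is inverted by induction on a quantity that drops strictly along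
  -- dominance.
  induction hN : ∑ i, shifted κ i ^ 2 using Nat.strong_induction_on generalizing κ with
  | _ N ih =>
    subst hN
    have key : ∀ Q ∈ Submodule.span ℂ ((fun μ => alternant (shifted μ)) ''
        {μ : Fin n → ℕ | Antitone μ ∧ DomLT μ κ}),
        ∃ R ∈ Submodule.span ℂ (monomialSymm '' {μ : Fin n → ℕ | Antitone μ ∧ DomLT μ κ}),
          vandermondePoly n * R = Q := by
      intro Q hQ
      induction hQ using Submodule.span_induction with
      | mem Q h =>
        obtain ⟨μ, ⟨hμ, hdom⟩, rfl⟩ := h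
        obtain ⟨P, hP, hspan⟩ := ih _ (sum_sq_shifted_lt hμ hdom) μ hμ rfl
        refine ⟨P, ?_, hP⟩
        rw [← sub_add_cancel P (monomialSymm μ)]
        refine Submodule.add_mem _ (Submodule.span_mono ?_ hspan)
          (Submodule.subset_span ⟨μ, ⟨hμ, hdom⟩, rfl⟩)
        exact Set.image_mono fun ν hν => ⟨hν.1, hν.2.trans hν.1 hμ hdom⟩
      | zero => exact ⟨0, Submodule.zero_mem _, by simp⟩
      | add Q₁ Q₂ _ _ h₁ h₂ =>
        obtain ⟨R₁, hR₁, rfl⟩ := h₁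
        obtain ⟨R₂, hR₂, rfl⟩ := h₂
        exact ⟨R₁ + R₂, Submodule.add_mem _ hR₁ hR₂, by ring⟩
      | smul c Q _ h =>
        obtain ⟨R, hR, rfl⟩ := h
        exact ⟨c • R, Submodule.smul_mem _ _ hR, by rw [mul_smul_comm]⟩
    obtain ⟨R, hR, hRe⟩ := key _ (vandermondePoly_mul_monomialSymm_sub_mem hκ)
    refine ⟨monomialSymm κ - R, by rw [mul_sub, hRe]; ring, ?_⟩
    rw [sub_sub_cancel_left]
    exact Submodule.neg_mem _ hR

/-- By transitivity of dominance, multiplication by the Vandermonde determinant sends the span of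
lower m_μ into the span of lower alternants. -/
lemma vandermondePoly_mul_sub_alternant_mem {n : ℕ} {κ : Fin n → ℕ} (hκ : Antitone κ)
    {P : MvPolynomial (Fin n) ℂ} (hP : P - monomialSymm κ ∈
      Submodule.span ℂ (monomialSymm '' {μ : Fin n → ℕ | Antitone μ ∧ DomLT μ κ})) :
    vandermondePoly n * P - alternant (shifted κ) ∈
      Submodule.span ℂ ((fun μ => alternant (shifted μ)) ''
        {μ : Fin n → ℕ | Antitone μ ∧ DomLT μ κ}) := by
  have key : ∀ R ∈ Submodule.span ℂ (monomialSymm '' {μ : Fin n → ℕ | Antitone μ ∧ DomLT μ κ}),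
      vandermondePoly n * R ∈ Submodule.span ℂ ((fun μ => alternant (shifted μ)) ''
        {μ : Fin n → ℕ | Antitone μ ∧ DomLT μ κ}) := by
    intro R hR
    induction hR using Submodule.span_induction with
    | mem R h =>
      obtain ⟨μ, ⟨hμ, hdom⟩, rfl⟩ := h
      rw [← sub_add_cancel (vandermondePoly n * monomialSymm μ) (alternant (shifted μ))]
      refine Submodule.add_mem _ (Submodule.span_mono ?_
        (vandermondePoly_mul_monomialSymm_sub_mem hμ))
        (Submodule.subset_span ⟨μ, ⟨hμ, hdom⟩, rfl⟩)
      exact Set.image_mono fun ν hν => ⟨hν.1, hν.2.trans hν.1 hμ hdom⟩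
    | zero => simp
    | add Q₁ Q₂ _ _ h₁ h₂ => rw [mul_add]; exact Submodule.add_mem _ h₁ h₂
    | smul c Q _ h => rw [mul_smul_comm]; exact Submodule.smul_mem _ _ h
  have h := Submodule.add_mem _ (key _ hP) (vandermondePoly_mul_monomialSymm_sub_mem hκ)
  convert h using 1
  ring

lemma isSymmetric_monomialSymm {n : ℕ} (κ : Fin n → ℕ) : (monomialSymm κ).IsSymmetric := by
  intro σ
  simp only [monomialSymm, map_sum, map_prod, map_pow, rename_X]
  refine Finset.sum_nbij' (fun ν => ν ∘ σ.symm) (fun ν => ν ∘ σ) ?_ ?_ ?_ ?_ ?_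
  · simp only [Finset.mem_image, Finset.mem_univ, true_and, forall_exists_index,
      forall_apply_eq_imp_iff]
    exact fun τ => ⟨σ.symm.trans τ, by ext; simp⟩
  · simp only [Finset.mem_image, Finset.mem_univ, true_and, forall_exists_index,
      forall_apply_eq_imp_iff]
    exact fun τ => ⟨σ.trans τ, by ext; simp⟩
  · intro ν _; ext; simp
  · intro ν _; ext; simp
  · intro ν _
    rw [← Equiv.prod_comp σ (fun i => X i ^ (ν ∘ σ.symm) i)]
    simp

lemma isSymmetric_of_sub_mem {n : ℕ} {κ : Fin n → ℕ} {P : MvPolynomial (Fin n) ℂ}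
    (hP : P - monomialSymm κ ∈
      Submodule.span ℂ (monomialSymm '' {μ : Fin n → ℕ | Antitone μ ∧ DomLT μ κ})) :
    P.IsSymmetric := by
  have key : ∀ R ∈ Submodule.span ℂ (monomialSymm '' {μ : Fin n → ℕ | Antitone μ ∧ DomLT μ κ}),
      R.IsSymmetric := by
    intro R hR
    induction hR using Submodule.span_induction with
    | mem R h =>
      obtain ⟨μ, -, rfl⟩ := h
      exact isSymmetric_monomialSymm μ
    | zero => exact IsSymmetric.zero
    | add Q₁ Q₂ _ _ h₁ h₂ => exact h₁.add h₂
    | smul c Q _ h => exact h.smul c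
  have h := (key _ hP).add (isSymmetric_monomialSymm κ)
  rwa [sub_add_cancel] at h

end JackHyp
end

noncomputable section
namespace JackHyp
open MvPolynomial

/-! ### The Jack operator at `α = 1` -/

lemma eval_vandermondePoly {n : ℕ} (x : Fin n → ℂ) :
    eval x (vandermondePoly n) = (Matrix.of fun j k : Fin n => x j ^ (k : ℕ)).det :=
  eval_alternant _ x

lemma eval_vandermondePoly_ne_zero {n : ℕ} {x : Fin n → ℂ} (hx : Function.Injective x) :
    eval x (vandermondePoly n) ≠ 0 := by
  rw [eval_vandermondePoly]
  exact Matrix.det_vandermonde_ne_zero_iff.mpr hx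

lemma vandermondePoly_ne_zero (n : ℕ) : vandermondePoly n ≠ 0 := by
  intro h
  have h1 := eval_vandermondePoly_ne_zero (x := fun i : Fin n => ((i : ℕ) : ℂ))
    (fun i j hij => Fin.ext (Nat.cast_injective hij))
  rw [h, map_zero] at h1
  exact h1 rfl

lemma vandermondePoly_eq_prod (n : ℕ) :
    vandermondePoly n = ∏ i : Fin n, ∏ j ∈ Finset.Ioi i, (X j - X i) :=
  Matrix.det_vandermonde (fun i : Fin n => (X i : MvPolynomial (Fin n) ℂ))

lemma eval_pderiv_prod {n : ℕ} {ι : Type*} (x : Fin n → ℂ) (i : Fin n) (S : Finset ι)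
    (F : ι → MvPolynomial (Fin n) ℂ) (hF : ∀ s ∈ S, eval x (F s) ≠ 0) :
    eval x (pderiv i (∏ s ∈ S, F s)) =
      eval x (∏ s ∈ S, F s) * ∑ s ∈ S, eval x (pderiv i (F s)) / eval x (F s) := by
  classical
  induction S using Finset.induction_on with
  | empty => simp
  | insert s S hs ih =>
    rw [Finset.prod_insert hs, Finset.sum_insert hs, pderiv_mul, map_add, map_mul, map_mul,
      ih fun t ht => hF t (Finset.mem_insert_of_mem ht), map_mul]
    have := hF s (Finset.mem_insert_self _ _)
    field_simp

/-- Logarithmic differentiation of the product formula; the resulting sum of 1/(x_i - x_j) is the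
singular coefficient of the Jack operator. -/
lemma eval_pderiv_vandermondePoly {n : ℕ} {x : Fin n → ℂ} (hx : Function.Injective x)
    (i : Fin n) :
    eval x (pderiv i (vandermondePoly n)) =
      eval x (vandermondePoly n) * ∑ j ∈ Finset.univ.erase i, 1 / (x i - x j) := by
  rw [vandermondePoly_eq_prod, Finset.prod_sigma', eval_pderiv_prod]
  · congr 1
    rw [← Finset.sum_sigma' Finset.univ (fun a : Fin n => Finset.Ioi a)
      (fun a b => eval x (pderiv i (X b - X a)) / eval x (X b - X a))]
    have h1 : ∀ a b : Fin n, eval x (pderiv i (X b - X a)) / eval x (X b - X a) =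
        (if b = i then 1 / (x b - x a) else 0) + (if a = i then 1 / (x a - x b) else 0) := by
      intro a b
      rw [map_sub, pderiv_X, pderiv_X, map_sub, map_sub, eval_X, eval_X, ← neg_sub (x b) (x a)]
      by_cases hb : b = i <;> by_cases ha : a = i <;> simp [hb, ha, neg_div, ← inv_neg]
    have h2 : ∀ (a : Fin n) (F : Fin n → ℂ), ∑ b ∈ Finset.Ioi a, F b =
        ∑ b, if a < b then F b else 0 := by
      intro a F
      rw [← Finset.sum_filter]
      congr 1
      ext; simp
    simp only [h2, h1, ite_add_zero, Finset.sum_add_distrib]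
    have h3 : ∑ a : Fin n, ∑ b : Fin n, (if a < b then if b = i then 1 / (x b - x a) else 0 else 0) =
        ∑ a : Fin n, if a < i then 1 / (x i - x a) else 0 := by
      refine Finset.sum_congr rfl fun a _ => ?_
      rw [Finset.sum_eq_single i]
      · simp
      · intro b _ hb; simp [hb]
      · simp
    have h4 : ∑ a : Fin n, ∑ b : Fin n, (if a < b then if a = i then 1 / (x a - x b) else 0 else 0) =
        ∑ b : Fin n, if i < b then 1 / (x i - x b) else 0 := by
      rw [Finset.sum_eq_single i]
      · simp
      · intro b _ hb; simp [hb]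
      · simp
    rw [h3, h4, ← Finset.sum_add_distrib, ← Finset.add_sum_erase _ _ (Finset.mem_univ i)]
    simp only [lt_self_iff_false, if_false, add_zero, zero_add]
    refine Finset.sum_congr rfl fun j hj => ?_
    rcases lt_or_gt_of_ne (Finset.ne_of_mem_erase hj) with h | h
    · simp [h, h.not_gt]
    · simp [h, h.not_gt]
  · rintro ⟨a, b⟩ hs
    simp only [Finset.mem_sigma, Finset.mem_Ioi, Finset.mem_univ, true_and] at hs
    simpa [sub_eq_zero] using hx.ne hs.ne'

lemma coeff_X_mul_pderiv {n : ℕ} (i : Fin n) (Q : MvPolynomial (Fin n) ℂ) (s : Fin n →₀ ℕ) :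
    MvPolynomial.coeff s (X i * pderiv i Q) = s i * MvPolynomial.coeff s Q := by
  induction Q using MvPolynomial.induction_on' with
  | monomial t a =>
    rw [X_mul_pderiv_monomial, coeff_smul, coeff_monomial]
    by_cases h : t = s
    · simp [h]
    · simp [h]
  | add P Q hP hQ => rw [map_add, mul_add, coeff_add, coeff_add, hP, hQ, mul_add]

lemma coeff_X_sq_mul_pderiv_pderiv {n : ℕ} (i : Fin n) (Q : MvPolynomial (Fin n) ℂ)
    (s : Fin n →₀ ℕ) :
    MvPolynomial.coeff s (X i ^ 2 * pderiv i (pderiv i Q)) =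
      s i * (s i - 1) * MvPolynomial.coeff s Q := by
  have h : X i ^ 2 * pderiv i (pderiv i Q) =
      X i * pderiv i (X i * pderiv i Q) - X i * pderiv i Q := by
    rw [pderiv_mul, pderiv_X_self]
    ring
  rw [h, coeff_sub, coeff_X_mul_pderiv, coeff_X_mul_pderiv]
  ring

/-- The conjugate of the Jack operator at `α = 1` by the Vandermonde determinant, up to an
additive constant. -/
def conjOp {n : ℕ} (Q : MvPolynomial (Fin n) ℂ) : MvPolynomial (Fin n) ℂ :=
  ∑ i, X i ^ 2 * pderiv i (pderiv i Q) - C (2 * ((n : ℂ) - 1)) * ∑ i, X i * pderiv i Q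

/-- The eigenvalue of `conjOp` on the monomial with exponents `e`. -/
def conjEigenvalue {n : ℕ} (e : Fin n → ℕ) : ℂ :=
  ∑ i, (e i : ℂ) * (e i - 1) - 2 * ((n : ℂ) - 1) * ∑ i, (e i : ℂ)

lemma coeff_conjOp {n : ℕ} (Q : MvPolynomial (Fin n) ℂ) (s : Fin n →₀ ℕ) :
    MvPolynomial.coeff s (conjOp Q) = conjEigenvalue s * MvPolynomial.coeff s Q := by
  rw [conjOp, coeff_sub, coeff_sum, coeff_C_mul, coeff_sum, conjEigenvalue]
  simp only [coeff_X_mul_pderiv, coeff_X_sq_mul_pderiv_pderiv, ← Finset.sum_mul]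
  ring

lemma conjEigenvalue_comp_perm {n : ℕ} (e : Fin n → ℕ) (σ : Equiv.Perm (Fin n)) :
    conjEigenvalue (e ∘ σ) = conjEigenvalue e := by
  simp only [conjEigenvalue, Function.comp_apply]
  rw [Equiv.sum_comp σ (fun i => (e i : ℂ) * (e i - 1)), Equiv.sum_comp σ (fun i => (e i : ℂ))]

lemma coeff_alternant_eq_zero {n : ℕ} {e : Fin n → ℕ} {s : Fin n →₀ ℕ}
    (h : conjEigenvalue s ≠ conjEigenvalue e) : MvPolynomial.coeff s (alternant e) = 0 := by
  rw [coeff_alternant]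
  refine Finset.sum_eq_zero fun σ _ => if_neg fun hσ => h ?_
  rw [← hσ, conjEigenvalue_comp_perm]

lemma conjOp_alternant {n : ℕ} (e : Fin n → ℕ) :
    conjOp (alternant e) = C (conjEigenvalue e) * alternant e := by
  ext s
  rw [coeff_conjOp, coeff_C_mul]
  by_cases h : conjEigenvalue s = conjEigenvalue e
  · rw [h]
  · rw [coeff_alternant_eq_zero h, mul_zero, mul_zero]

/-- For equal weights Σ e_i agrees, so the eigenvalues differ by the difference of Σ e_i², which is
non-zero. -/
lemma conjEigenvalue_shifted_ne {n : ℕ} {κ μ : Fin n → ℕ} (hμ : Antitone μ) (h : DomLT μ κ) :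
    conjEigenvalue (shifted μ) ≠ conjEigenvalue (shifted κ) := by
  have h1 := sum_sq_shifted_lt hμ h
  have h2 : (∑ i, (shifted μ i : ℂ)) = ∑ i, (shifted κ i : ℂ) := by
    exact_mod_cast congrArg (Nat.cast : ℕ → ℂ) (sum_shifted h.1)
  have h3 : ∀ e : Fin n → ℕ, conjEigenvalue e =
      ((∑ i, e i ^ 2 : ℕ) : ℂ) - (2 * (n : ℂ) - 1) * ∑ i, (e i : ℂ) := by
    intro e
    simp only [conjEigenvalue, mul_sub, Finset.sum_sub_distrib]
    push_cast
    simp only [sq]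
    ring_nf
  rw [h3, h3, h2]
  intro h4
  exact h1.ne (Nat.cast_injective (sub_left_injective h4))

/-- By the Leibniz rule, the cross terms 2 x_i² ∂_iΔ ∂_iP give the singular part of `opD` at `α =
1`. The terms with P undifferentiated form P times `conjOp` of Δ, and Δ, itself an alternant, is an
eigenvector. -/
lemma eval_vandermondePoly_mul_jackOp {n : ℕ} (P : MvPolynomial (Fin n) ℂ) {x : Fin n → ℂ}
    (hx : Function.Injective x) :
    eval x (vandermondePoly n) *
        (opD 1 2 P x - 2 / ((1 : ℝ) : ℂ) * ((n : ℂ) - 1) * opE 1 P x) =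
      eval x (conjOp (vandermondePoly n * P)) -
        conjEigenvalue (fun i : Fin n => (i : ℕ)) * eval x (vandermondePoly n * P) := by
  have hV := congrArg (eval x) (conjOp_alternant (fun i : Fin n => (i : ℕ)))
  change eval x (conjOp (vandermondePoly n)) = eval x (_ * vandermondePoly n) at hV
  rw [map_mul (eval x) _ (vandermondePoly n), eval_C] at hV
  rw [map_mul, ← mul_assoc, ← hV]
  simp only [conjOp, map_sub, map_sum, map_mul, map_pow, map_add, pderiv_mul, eval_X, eval_C,
    opD, opE, pow_one, Complex.ofReal_one, div_one]
  have hD : ∑ i, ∑ j ∈ Finset.univ.erase i, x i ^ 2 / (x i - x j) * eval x (pderiv i P) =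
      ∑ i, x i ^ 2 * (∑ j ∈ Finset.univ.erase i, 1 / (x i - x j)) * eval x (pderiv i P) := by
    refine Finset.sum_congr rfl fun i _ => ?_
    rw [Finset.mul_sum, Finset.sum_mul]
    exact Finset.sum_congr rfl fun j _ => by ring
  rw [hD]
  have hv := fun i => eval_pderiv_vandermondePoly hx i
  simp only [hv]
  obtain ⟨s, hs⟩ : ∃ s : Fin n → ℂ, ∀ i, ∑ j ∈ Finset.univ.erase i, 1 / (x i - x j) = s i :=
    ⟨_, fun _ => rfl⟩
  simp only [hs]
  generalize eval x (vandermondePoly n) = v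
  simp only [Finset.mul_sum, Finset.sum_mul, mul_add, mul_sub, sub_mul, ← Finset.sum_add_distrib,
    ← Finset.sum_sub_distrib]
  exact Finset.sum_congr rfl fun i _ => by ring

lemma conjOp_eq_of_eigen {n : ℕ} {P : MvPolynomial (Fin n) ℂ} {ε : ℂ}
    (h : ∀ x : Fin n → ℂ, Function.Injective x →
      opD 1 2 P x - 2 / ((1 : ℝ) : ℂ) * ((n : ℂ) - 1) * opE 1 P x = ε * eval x P) :
    conjOp (vandermondePoly n * P) =
      C (ε + conjEigenvalue (fun i : Fin n => (i : ℕ))) * (vandermondePoly n * P) := by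
  -- The eigenvalue equation is known only at distinct coordinates; an extra factor Δ makes the
  -- identity trivial elsewhere and is then cancelled.
  refine mul_left_cancel₀ (vandermondePoly_ne_zero n) (MvPolynomial.funext fun x => ?_)
  rw [map_mul, map_mul]
  by_cases hx : Function.Injective x
  · congr 1
    have h1 := eval_vandermondePoly_mul_jackOp P hx
    rw [h x hx] at h1
    rw [map_mul, eval_C, add_mul, ← sub_eq_iff_eq_add, ← h1, map_mul]
    ring
  · have h0 : eval x (vandermondePoly n) = 0 := by
      rw [eval_vandermondePoly]
      by_contra h0
      exact hx (Matrix.det_vandermonde_ne_zero_iff.mp h0)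
    rw [h0, zero_mul, zero_mul]

/-- A Jack polynomial of parameter `1` is the Schur polynomial. -/
lemma IsJack.vandermondePoly_mul {n : ℕ} {κ : Fin n → ℕ} (hκ : Antitone κ)
    {P : MvPolynomial (Fin n) ℂ} (hP : IsJack 1 κ P) :
    vandermondePoly n * P = alternant (shifted κ) := by
  obtain ⟨ε, hε⟩ := hP.eigen
  have heig := conjOp_eq_of_eigen hε
  generalize ε + conjEigenvalue (fun i : Fin n => (i : ℕ)) = ε' at heig
  -- Lower alternants contain no monomial with the eigenvalue of κ.
  have hR : ∀ R ∈ Submodule.span ℂ ((fun μ => alternant (shifted μ)) ''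
      {μ : Fin n → ℕ | Antitone μ ∧ DomLT μ κ}), ∀ s : Fin n →₀ ℕ,
      conjEigenvalue s = conjEigenvalue (shifted κ) → MvPolynomial.coeff s R = 0 := by
    intro R hR s hs
    induction hR using Submodule.span_induction with
    | mem R h =>
      obtain ⟨μ, ⟨hμ, hdom⟩, rfl⟩ := h
      exact coeff_alternant_eq_zero (hs ▸ (conjEigenvalue_shifted_ne hμ hdom).symm)
    | zero => simp
    | add Q₁ Q₂ _ _ h₁ h₂ => rw [coeff_add, h₁, h₂, add_zero]
    | smul c Q _ h => rw [coeff_smul, h, smul_zero]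
  replace hR := hR _ (vandermondePoly_mul_sub_alternant_mem hκ hP.triangular)
  have hcoeff : ∀ s : Fin n →₀ ℕ,
      conjEigenvalue s * MvPolynomial.coeff s (vandermondePoly n * P) =
        ε' * MvPolynomial.coeff s (vandermondePoly n * P) := by
    intro s
    rw [← coeff_conjOp, heig, coeff_C_mul]
  -- Read off at the leading monomial, whose coefficient is 1.
  have hε' : conjEigenvalue (shifted κ) = ε' := by
    set s : Fin n →₀ ℕ := Finsupp.equivFunOnFinite.symm (shifted κ) with hs
    have h1 : shifted κ = s := by simp [hs]
    have h2 := hR s (by rw [← h1])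
    rw [coeff_sub, coeff_alternant_self (shifted_strictMono hκ).injective h1, sub_eq_zero] at h2
    have h3 := hcoeff s
    rwa [h2, mul_one, mul_one, ← h1] at h3
  ext s
  by_cases hs : conjEigenvalue s = conjEigenvalue (shifted κ)
  · have := hR s hs
    rwa [coeff_sub, sub_eq_zero] at this
  · rw [coeff_alternant_eq_zero hs]
    have := hcoeff s
    rw [← hε', ← sub_eq_zero, ← sub_mul] at this
    exact (mul_eq_zero.mp this).resolve_left (sub_ne_zero.mpr hs)

lemma exists_isJack_one {n : ℕ} {κ : Fin n → ℕ} (hκ : Antitone κ) : ∃ P, IsJack 1 κ P := by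
  obtain ⟨P, hP, hspan⟩ := exists_vandermondePoly_mul_eq_alternant κ hκ
  refine ⟨P, isSymmetric_of_sub_mem hspan, hspan,
    conjEigenvalue (shifted κ) - conjEigenvalue (fun i : Fin n => (i : ℕ)), fun x hx => ?_⟩
  refine mul_left_cancel₀ (eval_vandermondePoly_ne_zero hx) ?_
  rw [eval_vandermondePoly_mul_jackOp P hx, hP, conjOp_alternant, ← hP]
  simp only [map_mul, eval_C]
  ring

/-- `jack` is a choice: existence selects the non-default branch, and every candidate satisfies this
equation. -/
lemma vandermondePoly_mul_jack {n : ℕ} {κ : Fin n → ℕ} (hκ : Antitone κ) :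
    vandermondePoly n * jack 1 κ = alternant (shifted κ) := by
  have h := exists_isJack_one hκ
  rw [jack, dif_pos h]
  exact h.choose_spec.vandermondePoly_mul hκ

end JackHyp
end

noncomputable section
namespace JackHyp
open MvPolynomial

/-! ### Specialisation at `(1, …, 1)` and hook lengths -/

/-- The difference product `∏_{i < j} (e_j - e_i)` of a sequence of exponents. -/
def diffProd {n : ℕ} (e : Fin n → ℕ) : ℂ :=
  ∏ i : Fin n, ∏ j ∈ Finset.Ioi i, ((e j : ℂ) - e i)

lemma diffProd_ne_zero {n : ℕ} {e : Fin n → ℕ} (he : Function.Injective e) : diffProd e ≠ 0 := by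
  refine Finset.prod_ne_zero_iff.mpr fun i _ => Finset.prod_ne_zero_iff.mpr fun j hj => ?_
  rw [sub_ne_zero]
  exact Nat.cast_injective.ne (he.ne (Finset.mem_Ioi.mp hj).ne')

/-- Both alternants may vanish at (1,…,1), so x_j = T^j is substituted first. Each alternant becomes
a Vandermonde determinant in the T^{e_k}; the common powers of T - 1 cancel and T = 1 is set. -/
lemma diffProd_mul_eval_one_jack {n : ℕ} {κ : Fin n → ℕ} (hκ : Antitone κ) :
    diffProd (fun i : Fin n => (i : ℕ)) * eval (fun _ => 1) (jack 1 κ) =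
      diffProd (shifted κ) := by
  set T : Polynomial ℂ := Polynomial.X with hT
  set ψ := aeval (R := ℂ) (fun j : Fin n => T ^ (j : ℕ)) with hψ
  set g : ℕ → ℕ → Polynomial ℂ :=
    fun a b => ∑ m ∈ Finset.range b, T ^ m - ∑ m ∈ Finset.range a, T ^ m with hg
  have hgT : ∀ a b : ℕ, T ^ b - T ^ a = (T - 1) * g a b := by
    intro a b
    rw [hg, mul_sub, mul_geom_sum, mul_geom_sum]
    ring
  have hg1 : ∀ a b : ℕ, (g a b).eval 1 = (b : ℂ) - a := by
    intro a b
    simp [hg, hT, Polynomial.eval_finsetSum]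
  have halt : ∀ e : Fin n → ℕ, ψ (alternant e) =
      (∏ i : Fin n, ∏ _j ∈ Finset.Ioi i, (T - 1)) *
        ∏ i : Fin n, ∏ j ∈ Finset.Ioi i, g (e i) (e j) := by
    intro e
    have h1 : ψ (alternant e) = (Matrix.vandermonde (fun k : Fin n => T ^ e k)).det := by
      rw [alternant, AlgHom.map_det, ← Matrix.det_transpose]
      congr 1
      ext i j : 2
      simp [hψ, Matrix.vandermonde_apply, ← pow_mul, mul_comm]
    rw [h1, Matrix.det_vandermonde]
    simp only [hgT, Finset.prod_mul_distrib]
  have h := congrArg ψ (vandermondePoly_mul_jack hκ)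
  rw [map_mul, vandermondePoly, halt, halt, mul_assoc] at h
  have hT1 : (T - 1) ≠ 0 := by
    simpa [hT] using Polynomial.X_sub_C_ne_zero (1 : ℂ)
  have h2 := mul_left_cancel₀ (Finset.prod_ne_zero_iff.mpr fun i _ =>
    Finset.prod_ne_zero_iff.mpr fun _ _ => hT1) h
  have h3 := congrArg (Polynomial.eval 1) h2
  simp only [Polynomial.eval_mul, Polynomial.eval_prod, hg1] at h3
  have h4 : Polynomial.eval 1 (ψ (jack 1 κ)) = eval (fun _ => 1) (jack 1 κ) := by
    have h5 : (Polynomial.aeval (1 : ℂ)).comp ψ = aeval (fun _ : Fin n => (1 : ℂ)) := by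
      ext i
      simp [hψ, hT]
    have h6 := congrArg (fun f => f (jack 1 κ)) h5
    simpa [Polynomial.coe_aeval_eq_eval, coe_aeval_eq_eval] using h6
  rw [h4] at h3
  exact h3

/-! ### Hook lengths and factorials. -/

/-- Since κ is antitone, the rows meeting a given column form an initial segment. -/
lemma lt_conjPart_iff {n : ℕ} {κ : Fin n → ℕ} (hκ : Antitone κ) (l : Fin n) (j : ℕ) :
    (l : ℕ) < conjPart κ j ↔ j < κ l := by
  constructor
  · intro h
    by_contra hl
    have hsub : Finset.univ.filter (fun i => j < κ i) ⊆ Finset.Iio l := by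
      intro i hi
      simp only [Finset.mem_filter, Finset.mem_univ, true_and] at hi
      rw [Finset.mem_Iio]
      by_contra hil
      exact hl (hi.trans_le (hκ (not_lt.mp hil)))
    have := Finset.card_le_card hsub
    rw [Fin.card_Iio] at this
    simp only [conjPart] at h
    omega
  · intro h
    have hsub : Finset.Iic l ⊆ Finset.univ.filter (fun i => j < κ i) := by
      intro i hi
      simp only [Finset.mem_filter, Finset.mem_univ, true_and]
      exact h.trans_le (hκ (Finset.mem_Iic.mp hi))
    have := Finset.card_le_card hsub
    rw [Fin.card_Iic] at this
    simp only [conjPart]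
    omega

lemma conjPart_antitone {n : ℕ} (κ : Fin n → ℕ) : Antitone (conjPart κ) := by
  intro j k hjk
  refine Finset.card_le_card fun i hi => ?_
  simp only [Finset.mem_filter, Finset.mem_univ, true_and] at hi ⊢
  omega

/-- The hook lengths in a row and the differences `f_i - f_l`, `l > i`, where
`f_i = κ_i + n - 1 - i`, together exhaust `1, …, f_i`. -/
lemma prod_hook_row_mul {n : ℕ} {κ : Fin n → ℕ} (hκ : Antitone κ) (i : Fin n) :
    (∏ j ∈ Finset.range (κ i), (κ i - j + (conjPart κ j - i - 1))) *
      ∏ l ∈ Finset.Ioi i, (κ i - κ l + (l - i : ℕ)) = (κ i + (n - 1 - i))! := by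
  have hc : ∀ j ∈ Finset.range (κ i), (i : ℕ) < conjPart κ j :=
    fun j hj => (lt_conjPart_iff hκ i j).mpr (Finset.mem_range.mp hj)
  have hle : ∀ j, conjPart κ j ≤ n := fun j => by
    simpa [conjPart] using Finset.card_le_univ (Finset.univ.filter (fun i => j < κ i))
  set h₁ : ℕ → ℕ := fun j => κ i - j + (conjPart κ j - i - 1) with hh₁
  set h₂ : Fin n → ℕ := fun l => κ i - κ l + (l - i : ℕ) with hh₂
  have inj₁ : Set.InjOn h₁ (Finset.range (κ i)) := by
    have : ∀ j k, j < k → k < κ i → h₁ k < h₁ j := by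
      intro j k hjk hk
      have := conjPart_antitone κ hjk.le
      simp only [hh₁]
      omega
    intro j hj k hk hjk
    simp only [Finset.coe_range, Set.mem_Iio] at hj hk
    rcases lt_trichotomy j k with h | h | h
    · exact absurd hjk (this j k h hk).ne'
    · exact h
    · exact absurd hjk (this k j h hj).ne
  have inj₂ : Set.InjOn h₂ (Finset.Ioi i) := by
    have : ∀ l m : Fin n, i < l → l < m → h₂ l < h₂ m := by
      intro l m hil hlm
      have := hκ hlm.le
      have h3 : (i : ℕ) < l := hil
      have h4 : (l : ℕ) < m := hlm
      simp only [hh₂]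
      omega
    intro l hl m hm hlm
    simp only [Finset.coe_Ioi, Set.mem_Ioi] at hl hm
    rcases lt_trichotomy l m with h | h | h
    · exact absurd hlm (this l m hl h).ne
    · exact h
    · exact absurd hlm (this m l hm h).ne'
  -- If row l meets column j, the hook length exceeds the difference attached to l; otherwise it is
  -- smaller.
  have hdisj : Disjoint ((Finset.range (κ i)).image h₁) ((Finset.Ioi i).image h₂) := by
    rw [Finset.disjoint_left]
    intro a ha hb
    obtain ⟨j, hj, rfl⟩ := Finset.mem_image.mp ha
    obtain ⟨l, hl, hlj⟩ := Finset.mem_image.mp hb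
    have h3 := hc j hj
    rw [Finset.mem_range] at hj
    have h4 : (i : ℕ) < l := Fin.lt_def.mp (Finset.mem_Ioi.mp hl)
    have h5 := hκ (Finset.mem_Ioi.mp hl).le
    have h6 := lt_conjPart_iff hκ l j
    simp only [hh₁, hh₂] at hlj
    omega
  -- Both images lie in the interval, and their sizes κ_i and n - 1 - i add up to its cardinality.
  have hun : (Finset.range (κ i)).image h₁ ∪ (Finset.Ioi i).image h₂ =
      Finset.Icc 1 (κ i + (n - 1 - i)) := by
    refine Finset.eq_of_subset_of_card_le ?_ ?_
    · refine Finset.union_subset ?_ ?_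
      · intro a ha
        obtain ⟨j, hj, rfl⟩ := Finset.mem_image.mp ha
        have h3 := hle j
        rw [Finset.mem_range] at hj
        rw [Finset.mem_Icc]
        simp only [hh₁]
        omega
      · intro a ha
        obtain ⟨l, hl, rfl⟩ := Finset.mem_image.mp ha
        have h3 := l.2
        have h4 : (i : ℕ) < l := Fin.lt_def.mp (Finset.mem_Ioi.mp hl)
        rw [Finset.mem_Icc]
        simp only [hh₂]
        omega
    · rw [Finset.card_union_of_disjoint hdisj, Finset.card_image_of_injOn inj₁,
        Finset.card_image_of_injOn inj₂, Finset.card_range, Fin.card_Ioi, Nat.card_Icc]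
      omega
  rw [← Finset.prod_Ico_id_eq_factorial, Finset.Ico_add_one_right_eq_Icc, ← hun, Finset.prod_union hdisj,
    Finset.prod_image inj₁, Finset.prod_image inj₂]

lemma hook_mul_diffProd {n : ℕ} {κ : Fin n → ℕ} (hκ : Antitone κ) :
    hook 1 κ * diffProd (shifted κ) = ∏ i, ((shifted κ i)! : ℂ) := by
  have hd : diffProd (shifted κ) =
      ∏ i : Fin n, ∏ l ∈ Finset.Ioi i, ((κ i - κ l + (l - i : ℕ) : ℕ) : ℂ) := by
    rw [diffProd, Finset.prod_comm' (t' := Finset.univ) (s' := fun j : Fin n => Finset.Iio j)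
      (by simp), ← Equiv.prod_comp Fin.revPerm]
    refine Finset.prod_congr rfl fun i _ => ?_
    refine Finset.prod_nbij' Fin.rev Fin.rev ?_ ?_ (by simp) (by simp) ?_
    · intro l hl
      simpa [Fin.lt_rev_iff] using hl
    · intro l hl
      simpa using hl
    · intro l hl
      have h1 : Fin.rev l > i := by simpa [Fin.lt_rev_iff] using hl
      have h2 := hκ h1.le
      have h3 : (i : ℕ) < Fin.rev l := h1
      simp only [shifted, Fin.revPerm_apply, Fin.rev_rev, Fin.val_rev] at h3 ⊢
      rw [sub_eq_iff_eq_add, ← Nat.cast_add]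
      congr 1
      omega
  have hh : hook 1 κ = ∏ i : Fin n, ∏ j ∈ Finset.range (κ i),
      ((κ i - j + (conjPart κ j - i - 1) : ℕ) : ℂ) := by
    refine Finset.prod_congr rfl fun i _ => Finset.prod_congr rfl fun j hj => ?_
    have h1 := (lt_conjPart_iff hκ i j).mpr (Finset.mem_range.mp hj)
    rw [Finset.mem_range] at hj
    rw [Nat.cast_add, Nat.cast_sub hj.le, Nat.sub_sub, Nat.cast_sub (by omega)]
    push_cast
    ring
  rw [hd, hh, ← Finset.prod_mul_distrib,
    ← Equiv.prod_comp Fin.revPerm (fun i => ((shifted κ i)! : ℂ))]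
  refine Finset.prod_congr rfl fun i _ => ?_
  rw [← Nat.cast_prod, ← Nat.cast_prod, ← Nat.cast_mul, prod_hook_row_mul hκ i]
  simp only [shifted, Fin.revPerm_apply, Fin.rev_rev, Fin.val_rev]
  congr 3
  omega

lemma hook_zero (n : ℕ) : hook 1 (0 : Fin n → ℕ) = 1 := by
  simp [hook]

/-- The hook identity for the empty partition. -/
lemma diffProd_val (n : ℕ) :
    diffProd (fun i : Fin n => (i : ℕ)) = ∏ i ∈ Finset.range n, ((i)! : ℂ) := by
  have h := hook_mul_diffProd (n := n) (κ := 0) (fun _ _ _ => le_rfl)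
  rw [hook_zero, one_mul] at h
  have hs : shifted (0 : Fin n → ℕ) = fun i : Fin n => (i : ℕ) := by funext i; simp [shifted]
  rw [hs] at h
  rw [h, Finset.prod_range]

end JackHyp
end

noncomputable section
namespace JackHyp

/-! ### The Cauchy–Binet formula for series -/

lemma summable_prod_and_prod_tsum {n : ℕ} (u : Fin n → ℕ → ℂ)
    (hu : ∀ j, Summable fun k => ‖u j k‖) :
    (Summable fun g : Fin n → ℕ => ‖∏ j, u j (g j)‖) ∧
      ∏ j, ∑' k, u j k = ∑' g : Fin n → ℕ, ∏ j, u j (g j) := by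
  induction n with
  | zero => exact ⟨Summable.of_finite, by simp⟩
  | succ n ih =>
    obtain ⟨h1, h2⟩ := ih (fun j => u j.succ) (fun j => hu j.succ)
    have h3 := (hu 0).mul_norm h1
    have e : ∀ x : ℕ × (Fin n → ℕ), ∏ j, u j (Fin.consEquiv (fun _ => ℕ) x j) =
        u 0 x.1 * ∏ j : Fin n, u j.succ (x.2 j) := by
      intro x
      rw [Fin.prod_univ_succ]
      simp [Fin.consEquiv]
    constructor
    · rw [← (Fin.consEquiv (fun _ : Fin (n + 1) => ℕ)).summable_iff]
      refine h3.congr fun x => ?_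
      rw [Function.comp_apply, e]
    · rw [Fin.prod_univ_succ, h2, tsum_mul_tsum_of_summable_norm (hu 0) h1,
        ← (Fin.consEquiv (fun _ : Fin (n + 1) => ℕ)).tsum_eq]
      exact tsum_congr fun x => (e x).symm

/-- Expand the determinant over permutations, multiply out each product of series over all g, and
reassemble a determinant for each g. -/
lemma summable_and_det_tsum {n : ℕ} (u v : Fin n → ℕ → ℂ)
    (huv : ∀ j l, Summable fun k => ‖u j k * v l k‖) :
    (Summable fun g : Fin n → ℕ =>
      ‖(∏ j, u j (g j)) * (Matrix.of fun j l : Fin n => v l (g j)).det‖) ∧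
    (Matrix.of fun j l : Fin n => ∑' k, u j k * v l k).det =
      ∑' g : Fin n → ℕ, (∏ j, u j (g j)) * (Matrix.of fun j l : Fin n => v l (g j)).det := by
  have hdet : ∀ M : Matrix (Fin n) (Fin n) ℂ, M.det =
      ∑ σ : Equiv.Perm (Fin n), ((Equiv.Perm.sign σ : ℤ) : ℂ) * ∏ j, M j (σ j) := by
    intro M
    rw [← Matrix.det_transpose, Matrix.det_apply']
    rfl
  have hexp : ∀ g : Fin n → ℕ, (∏ j, u j (g j)) * (Matrix.of fun j l : Fin n => v l (g j)).det =
      ∑ σ : Equiv.Perm (Fin n), ((Equiv.Perm.sign σ : ℤ) : ℂ) *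
        ∏ j, (u j (g j) * v (σ j) (g j)) := by
    intro g
    rw [hdet, Finset.mul_sum]
    refine Finset.sum_congr rfl fun σ _ => ?_
    rw [Finset.prod_mul_distrib]
    simp only [Matrix.of_apply]
    ring
  have hσ := fun σ : Equiv.Perm (Fin n) =>
    summable_prod_and_prod_tsum (fun j k => u j k * v (σ j) k) (fun j => huv j (σ j))
  simp only [hexp]
  constructor
  · refine Summable.of_nonneg_of_le (fun _ => norm_nonneg _) (fun g => norm_sum_le _ _) ?_
    refine summable_sum fun σ _ => ?_
    simp only [norm_mul]
    refine Summable.mul_left _ ?_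
    simpa only [norm_mul] using (hσ σ).1
  · rw [Summable.tsum_finsetSum fun σ _ => ((hσ σ).1.of_norm).mul_left _, hdet]
    refine Finset.sum_congr rfl fun σ _ => ?_
    rw [tsum_mul_left, ← (hσ σ).2]
    rfl

/-- Injective sequences are permuted strictly increasing sequences. -/
def strictMonoProdPermEquiv (n : ℕ) :
    {e : Fin n → ℕ // StrictMono e} × Equiv.Perm (Fin n) ≃
      {g : Fin n → ℕ // Function.Injective g} :=
  Equiv.ofBijective (fun x => ⟨x.1.1 ∘ x.2, x.1.2.injective.comp x.2.injective⟩) <| by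
    constructor
    · rintro ⟨⟨e, he⟩, τ⟩ ⟨⟨e', he'⟩, τ'⟩ h
      have h1 : e ∘ τ = e' ∘ τ' := Subtype.ext_iff.mp h
      have h2 : e = e' := by
        rw [← StrictMono.range_inj he he', ← EquivLike.range_comp e τ, h1, EquivLike.range_comp]
      subst h2
      have h3 : τ = τ' := by
        ext i : 1
        exact he.injective (congrFun h1 i)
      rw [h3]
    · rintro ⟨g, hg⟩
      obtain ⟨τ, hτ⟩ := exists_perm_strictMono hg
      exact ⟨⟨⟨g ∘ τ, hτ⟩, τ.symm⟩, Subtype.ext (by ext; simp)⟩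

/-- The Cauchy–Binet formula for absolutely convergent series. -/
theorem summable_and_det_tsum_eq_tsum_strictMono {n : ℕ} (u v : Fin n → ℕ → ℂ)
    (huv : ∀ j l, Summable fun k => ‖u j k * v l k‖) :
    (Summable fun e : {e : Fin n → ℕ // StrictMono e} =>
      ‖(Matrix.of fun j i : Fin n => u j (e.1 i)).det *
        (Matrix.of fun i l : Fin n => v l (e.1 i)).det‖) ∧
    (Matrix.of fun j l : Fin n => ∑' k, u j k * v l k).det =
      ∑' e : {e : Fin n → ℕ // StrictMono e}, (Matrix.of fun j i : Fin n => u j (e.1 i)).det *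
        (Matrix.of fun i l : Fin n => v l (e.1 i)).det := by
  obtain ⟨h1, h2⟩ := summable_and_det_tsum u v huv
  set F : (Fin n → ℕ) → ℂ :=
    fun g => (∏ j, u j (g j)) * (Matrix.of fun j l : Fin n => v l (g j)).det with hF
  -- Permuting the rows of the v-determinant yields the signs that turn the products of the u's into
  -- a determinant.
  have hsum : ∀ e : {e : Fin n → ℕ // StrictMono e},
      (Matrix.of fun j i : Fin n => u j (e.1 i)).det *
        (Matrix.of fun i l : Fin n => v l (e.1 i)).det =
      ∑ τ : Equiv.Perm (Fin n), F (e.1 ∘ τ) := by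
    intro e
    rw [← Matrix.det_transpose, Matrix.det_apply', Finset.sum_mul]
    refine Finset.sum_congr rfl fun τ _ => ?_
    have h3 := Matrix.det_permute τ (Matrix.of fun i l : Fin n => v l (e.1 i))
    simp only [hF, Function.comp_apply]
    rw [show (Matrix.of fun j l : Fin n => v l (e.1 (τ j))) =
      (Matrix.of fun i l : Fin n => v l (e.1 i)).submatrix τ id from rfl, h3]
    simp only [Matrix.transpose_apply, Matrix.of_apply]
    ring
  -- A repeated value of g gives two equal rows.
  have hsub : Function.support F ⊆ {g : Fin n → ℕ | Function.Injective g} := by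
    intro g hg
    by_contra hinj
    simp only [Set.mem_ofPred_eq, Function.Injective, not_forall] at hinj
    obtain ⟨i, j, hij, hne⟩ := hinj
    apply hg
    simp only [hF]
    rw [Matrix.det_zero_of_row_eq hne (by funext l; simp [hij]), mul_zero]
  have h4 : Summable fun x : {e : Fin n → ℕ // StrictMono e} × Equiv.Perm (Fin n) =>
      ‖F (x.1.1 ∘ x.2)‖ :=
    (strictMonoProdPermEquiv n).summable_iff.mpr
      (h1.subtype {g : Fin n → ℕ | Function.Injective g})
  have h5 : ∑' g, F g = ∑' x : {e : Fin n → ℕ // StrictMono e} × Equiv.Perm (Fin n),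
      F (x.1.1 ∘ x.2) := by
    rw [← tsum_subtype_eq_of_support_subset hsub]
    exact ((strictMonoProdPermEquiv n).tsum_eq
      (fun g : {g : Fin n → ℕ // Function.Injective g} => F g.1)).symm
  simp only [hsum]
  constructor
  · refine Summable.of_nonneg_of_le (fun _ => norm_nonneg _) (fun e => norm_sum_le _ _) ?_
    simpa only [tsum_fintype] using h4.prod
  · rw [h2, h5, h4.of_norm.tsum_prod]
    simp only [tsum_fintype]

end JackHyp
end

noncomputable section
namespace JackHyp
open Filter Topology

/-! ### The classical hypergeometric series -/

/-- The coefficient of `z ^ k` in `ₚf_q`. -/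
def pfqCoeff {p q : ℕ} (a : Fin p → ℂ) (b : Fin q → ℂ) (k : ℕ) : ℂ :=
  (∏ r, poch (a r) k) / (∏ s, poch (b s) k) / (k ! : ℂ)

lemma pfq_eq_tsum {p q : ℕ} (a : Fin p → ℂ) (b : Fin q → ℂ) (z : ℂ) :
    pfq a b z = ∑' k, pfqCoeff a b k * z ^ k :=
  tsum_congr fun k => by rw [pfqCoeff]; ring

lemma poch_succ (z : ℂ) (k : ℕ) : poch z (k + 1) = poch z k * (z + k) :=
  ascPochhammer_succ_eval k z

/-- The ratio of consecutive coefficients of `ₚf_q`. -/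
def pfqRatio {p q : ℕ} (a : Fin p → ℂ) (b : Fin q → ℂ) (k : ℕ) : ℂ :=
  (∏ r, (a r + k)) / ((∏ s, (b s + k)) * (k + 1))

lemma pfqCoeff_succ {p q : ℕ} (a : Fin p → ℂ) (b : Fin q → ℂ) (k : ℕ) :
    pfqCoeff a b (k + 1) = pfqCoeff a b k * pfqRatio a b k := by
  simp only [pfqCoeff, pfqRatio, poch_succ, Finset.prod_mul_distrib, Nat.factorial_succ]
  push_cast
  simp only [div_eq_mul_inv, mul_inv]
  ring

lemma tendsto_add_div_add_one (c : ℂ) :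
    Tendsto (fun k : ℕ => (c + k) / ((k : ℂ) + 1)) atTop (𝓝 1) := by
  have h : Tendsto (fun k : ℕ => 1 + (c - 1) * (1 / ((k : ℂ) + 1))) atTop (𝓝 (1 + (c - 1) * 0)) :=
    tendsto_const_nhds.add (tendsto_const_nhds.mul tendsto_one_div_add_atTop_nhds_zero_nat)
  rw [mul_zero, add_zero] at h
  refine h.congr fun k => ?_
  have := Nat.cast_add_one_ne_zero (R := ℂ) k
  field_simp
  ring

/-- The normalised factors tend to 1, so only the power of k + 1 governs the limit. -/
lemma pfqRatio_eq {p q : ℕ} (a : Fin p → ℂ) (b : Fin q → ℂ) (k : ℕ) :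
    pfqRatio a b k = (∏ r, ((a r + k) / ((k : ℂ) + 1))) / (∏ s, ((b s + k) / ((k : ℂ) + 1))) *
      (((k : ℂ) + 1) ^ p / ((k : ℂ) + 1) ^ (q + 1)) := by
  have := Nat.cast_add_one_ne_zero (R := ℂ) k
  simp only [pfqRatio, Finset.prod_div_distrib, Finset.prod_const, Finset.card_univ,
    Fintype.card_fin]
  field_simp
  ring

lemma tendsto_pfqRatio {p q : ℕ} (a : Fin p → ℂ) (b : Fin q → ℂ) {L : ℂ}
    (hL : Tendsto (fun k : ℕ => ((k : ℂ) + 1) ^ p / ((k : ℂ) + 1) ^ (q + 1)) atTop (𝓝 L)) :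
    Tendsto (pfqRatio a b) atTop (𝓝 L) := by
  have h1 : Tendsto (fun k : ℕ => ∏ r, ((a r + k) / ((k : ℂ) + 1))) atTop (𝓝 (∏ _r : Fin p, 1)) :=
    tendsto_finsetProd _ fun r _ => tendsto_add_div_add_one (a r)
  have h2 : Tendsto (fun k : ℕ => ∏ s, ((b s + k) / ((k : ℂ) + 1))) atTop (𝓝 (∏ _s : Fin q, 1)) :=
    tendsto_finsetProd _ fun s _ => tendsto_add_div_add_one (b s)
  have h3 := (h1.div h2 (by simp)).mul hL
  simp only [Finset.prod_const_one, div_one, one_mul] at h3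
  exact h3.congr fun k => (pfqRatio_eq a b k).symm

lemma tendsto_pfqRatio_zero {p q : ℕ} (a : Fin p → ℂ) (b : Fin q → ℂ) (hpq : p ≤ q) :
    Tendsto (pfqRatio a b) atTop (𝓝 0) := by
  refine tendsto_pfqRatio a b ?_
  have h := (tendsto_one_div_add_atTop_nhds_zero_nat (𝕜 := ℂ)).pow (q - p + 1)
  rw [zero_pow (by omega)] at h
  refine h.congr fun k => ?_
  have := Nat.cast_add_one_ne_zero (R := ℂ) k
  rw [one_div, inv_pow, eq_div_iff (pow_ne_zero _ this), inv_mul_eq_iff_eq_mul₀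
    (pow_ne_zero _ this), ← pow_add]
  congr 1
  omega

lemma tendsto_pfqRatio_one {p q : ℕ} (a : Fin p → ℂ) (b : Fin q → ℂ) (hpq : p = q + 1) :
    Tendsto (pfqRatio a b) atTop (𝓝 1) := by
  subst hpq
  refine tendsto_pfqRatio a b (tendsto_const_nhds.congr fun k => ?_)
  rw [div_self (pow_ne_zero _ (Nat.cast_add_one_ne_zero k))]

/-- Ratio test. The weight (k+1)^l, whose ratio tends to 1, leaves room for l derivatives. -/
lemma summable_of_tendsto_pfqRatio {p q : ℕ} (a : Fin p → ℂ) (b : Fin q → ℂ) {L : ℂ}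
    (hL : Tendsto (pfqRatio a b) atTop (𝓝 L)) {r : ℝ} (hr : 0 ≤ r) (hLr : ‖L‖ * r < 1) (l : ℕ) :
    Summable fun k : ℕ => ‖pfqCoeff a b k‖ * ((k : ℝ) + 1) ^ l * r ^ k := by
  obtain ⟨c, hc, hc1⟩ := exists_between hLr
  have hq : Tendsto (fun k : ℕ => ((k : ℝ) + 1 + 1) / ((k : ℝ) + 1)) atTop (𝓝 1) := by
    have h : Tendsto (fun k : ℕ => 1 + 1 / ((k : ℝ) + 1)) atTop (𝓝 (1 + 0)) :=
      tendsto_const_nhds.add tendsto_one_div_add_atTop_nhds_zero_nat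
    rw [add_zero] at h
    refine h.congr fun k => ?_
    have := Nat.cast_add_one_ne_zero (R := ℝ) k
    field_simp
  have h2 := (hL.norm.mul_const r).mul (hq.pow l)
  rw [one_pow, mul_one] at h2
  refine summable_of_ratio_norm_eventually_le hc1 ?_
  filter_upwards [h2.eventually (gt_mem_nhds hc)] with k hk
  have hk1 : (0 : ℝ) < (k : ℝ) + 1 := by positivity
  have e : ‖pfqCoeff a b (k + 1)‖ * (((k + 1 : ℕ) : ℝ) + 1) ^ l * r ^ (k + 1) =
      (‖pfqRatio a b k‖ * r * (((k : ℝ) + 1 + 1) / ((k : ℝ) + 1)) ^ l) *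
        (‖pfqCoeff a b k‖ * ((k : ℝ) + 1) ^ l * r ^ k) := by
    rw [pfqCoeff_succ, norm_mul, div_pow]
    push_cast
    field_simp
    ring
  rw [e, Real.norm_of_nonneg (by positivity), Real.norm_of_nonneg (by positivity)]
  exact mul_le_mul_of_nonneg_right hk.le (by positivity)

lemma pfqCoeff_eq_zero {p q : ℕ} (a : Fin p → ℂ) (b : Fin q → ℂ) {r : Fin p} {m : ℕ}
    (hr : a r = -(m : ℂ)) {k : ℕ} (hk : m < k) : pfqCoeff a b k = 0 := by
  have h : poch (a r) k = 0 := by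
    rw [poch, hr, ascPochhammer_eval_neg_coe_nat_of_lt hk]
  rw [pfqCoeff, Finset.prod_eq_zero (Finset.mem_univ r) h, zero_div, zero_div]

/-- The strict inequality ρ < R allows termwise differentiation at points of modulus ρ. In the first
and third cases every radius works, and ρ + 1 is an arbitrary choice. -/
lemma exists_radius_summable_pfqCoeff {p q : ℕ} (a : Fin p → ℂ) (b : Fin q → ℂ) (ρ : ℝ)
    (h : p ≤ q ∨ (p = q + 1 ∧ ρ < 1) ∨ ∃ r, ∃ m : ℕ, a r = -(m : ℂ)) :
    ∃ R, ρ < R ∧ ∀ r, 0 ≤ r → r < R → ∀ l : ℕ,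
      Summable fun k : ℕ => ‖pfqCoeff a b k‖ * ((k : ℝ) + 1) ^ l * r ^ k := by
  rcases h with h | ⟨h, hρ⟩ | ⟨r₀, m, hm⟩
  · exact ⟨ρ + 1, lt_add_one ρ, fun r hr _ l =>
      summable_of_tendsto_pfqRatio a b (tendsto_pfqRatio_zero a b h) hr (by simp) l⟩
  · exact ⟨1, hρ, fun r hr hr1 l =>
      summable_of_tendsto_pfqRatio a b (tendsto_pfqRatio_one a b h) hr (by simpa using hr1) l⟩
  · refine ⟨ρ + 1, lt_add_one ρ, fun r hr _ l => ?_⟩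
    refine summable_of_hasFiniteSupport ((Set.finite_Iic m).subset fun k hk => ?_)
    by_contra hmk
    exact hk (by simp [pfqCoeff_eq_zero a b hm (not_le.mp hmk)])

lemma descFactorial_mul_pow_le (k l : ℕ) {r : ℝ} (hr : 0 < r) :
    (k.descFactorial l : ℝ) * r ^ (k - l) ≤ (r ^ l)⁻¹ * (((k : ℝ) + 1) ^ l * r ^ k) := by
  by_cases hkl : k < l
  · rw [Nat.descFactorial_of_lt hkl, Nat.cast_zero, zero_mul]
    positivity
  · have h1 : (k.descFactorial l : ℝ) ≤ ((k : ℝ) + 1) ^ l := by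
      exact_mod_cast (Nat.descFactorial_le_pow k l).trans (Nat.pow_le_pow_left (Nat.le_succ k) l)
    have h2 : r ^ (k - l) = (r ^ l)⁻¹ * r ^ k := by
      rw [eq_inv_mul_iff_mul_eq₀ (by positivity), ← pow_add]
      congr 1
      omega
    rw [h2]
    calc (k.descFactorial l : ℝ) * ((r ^ l)⁻¹ * r ^ k)
        ≤ ((k : ℝ) + 1) ^ l * ((r ^ l)⁻¹ * r ^ k) :=
          mul_le_mul_of_nonneg_right h1 (by positivity)
      _ = _ := by ring

/-- Termwise iterated differentiation of a power series. -/
lemma iteratedDeriv_tsum_pow (c : ℕ → ℂ) {R : ℝ}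
    (hc : ∀ r, 0 ≤ r → r < R → ∀ l : ℕ,
      Summable fun k : ℕ => ‖c k‖ * ((k : ℝ) + 1) ^ l * r ^ k) (l : ℕ) :
    ∀ z : ℂ, ‖z‖ < R → iteratedDeriv l (fun z => ∑' k, c k * z ^ k) z =
      ∑' k, c k * ((k.descFactorial l : ℂ) * z ^ (k - l)) := by
  induction l with
  | zero => intro z _; simp
  | succ l ih =>
    intro z hz
    -- On the disc of radius r the differentiated series is dominated by its value at r.
    obtain ⟨r, hzr, hrR⟩ := exists_between hz
    have hr : 0 < r := (norm_nonneg z).trans_lt hzr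
    have hsum : ∀ l, Summable fun k => ‖c k‖ * ((k.descFactorial l : ℝ) * r ^ (k - l)) := by
      intro l
      refine Summable.of_nonneg_of_le (fun k => by positivity) (fun k => ?_)
        ((hc r hr.le hrR l).mul_left (r ^ l)⁻¹)
      calc ‖c k‖ * ((k.descFactorial l : ℝ) * r ^ (k - l))
          ≤ ‖c k‖ * ((r ^ l)⁻¹ * (((k : ℝ) + 1) ^ l * r ^ k)) :=
            mul_le_mul_of_nonneg_left (descFactorial_mul_pow_le k l hr) (norm_nonneg _)
        _ = _ := by ring
    have hbound : ∀ l k, ∀ y : ℂ, ‖y‖ < r →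
        ‖c k * ((k.descFactorial l : ℂ) * y ^ (k - l))‖ ≤
          ‖c k‖ * ((k.descFactorial l : ℝ) * r ^ (k - l)) := by
      intro l k y hy
      rw [norm_mul, norm_mul, norm_pow, Complex.norm_natCast]
      gcongr
    have hder : HasDerivAt (fun z => ∑' k, c k * ((k.descFactorial l : ℂ) * z ^ (k - l)))
        (∑' k, c k * ((k.descFactorial (l + 1) : ℂ) * z ^ (k - (l + 1)))) z := by
      refine hasDerivAt_tsum_of_isPreconnected (hsum (l + 1)) Metric.isOpen_ball
        (convex_ball (0 : ℂ) r).isPreconnected (fun k y _ => ?_)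
        (fun k y hy => hbound (l + 1) k y (by simpa using hy))
        (y₀ := z) (by simpa using hzr) ?_ (by simpa using hzr)
      · have h := (((hasDerivAt_pow (k - l) y).const_mul (k.descFactorial l : ℂ)).const_mul (c k))
        refine h.congr_deriv ?_
        rw [Nat.descFactorial_succ, Nat.sub_sub]
        push_cast
        ring
      · exact Summable.of_norm_bounded (hsum l) fun k => hbound l k z hzr
    rw [iteratedDeriv_succ, ← hder.deriv]
    refine Filter.EventuallyEq.deriv_eq ?_
    filter_upwards [Metric.isOpen_ball.mem_nhds (show z ∈ Metric.ball (0 : ℂ) R by simpa using hz)]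
      with w hw
    exact ih w (by simpa using hw)

/-- The factor z^l restores z^k; where k - l is truncated, the falling factorial vanishes. -/
lemma pow_mul_iteratedDeriv_pfq {p q : ℕ} (a : Fin p → ℂ) (b : Fin q → ℂ) {R : ℝ}
    (hc : ∀ r, 0 ≤ r → r < R → ∀ l : ℕ,
      Summable fun k : ℕ => ‖pfqCoeff a b k‖ * ((k : ℝ) + 1) ^ l * r ^ k) (l : ℕ)
    {z : ℂ} (hz : ‖z‖ < R) :
    z ^ l * iteratedDeriv l (pfq a b) z =
      ∑' k, pfqCoeff a b k * z ^ k * (k.descFactorial l : ℂ) := by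
  rw [show pfq a b = fun z => ∑' k, pfqCoeff a b k * z ^ k from funext (pfq_eq_tsum a b),
    iteratedDeriv_tsum_pow _ hc l z hz, ← tsum_mul_left]
  refine tsum_congr fun k => ?_
  by_cases hkl : k < l
  · simp [Nat.descFactorial_of_lt hkl]
  · have : z ^ k = z ^ l * z ^ (k - l) := by
      rw [← pow_add]
      congr 1
      omega
    rw [this]
    ring

end JackHyp
end

noncomputable section
namespace JackHyp
open MvPolynomial

/-! ### The terms of the series -/

lemma poch_add (z : ℂ) (m k : ℕ) : poch z (m + k) = poch z m * poch (z + m) k := by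
  induction k with
  | zero => simp [poch]
  | succ k ih =>
    rw [← add_assoc, poch_succ, poch_succ, ih]
    push_cast
    ring

lemma poch_ne_zero {z : ℂ} {k : ℕ} (h : ∀ i < k, z ≠ -(i : ℂ)) : poch z k ≠ 0 := by
  induction k with
  | zero => simp [poch]
  | succ k ih =>
    rw [poch_succ]
    refine mul_ne_zero (ih fun i hi => h i (hi.trans (Nat.lt_succ_self k))) fun h0 => ?_
    exact h k (Nat.lt_succ_self k) (eq_neg_of_add_eq_zero_left h0)

/-- The shift by n - 1 makes the i-th factor start at z + m with m = n - 1 - i, so (z)_m (z+m)_{κ_i}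
= (z)_{m+κ_i}. -/
lemma jackPoch_mul_prod {n : ℕ} (z : ℂ) (κ : Fin n → ℕ) :
    (∏ i ∈ Finset.range n, poch z i) * jackPoch 1 (z + n - 1) κ =
      ∏ i, poch z (shifted κ i) := by
  rw [Finset.prod_range, ← Equiv.prod_comp Fin.revPerm (fun i : Fin n => poch z i),
    ← Equiv.prod_comp Fin.revPerm (fun i : Fin n => poch z (shifted κ i)), jackPoch,
    ← Finset.prod_mul_distrib]
  refine Finset.prod_congr rfl fun i _ => ?_
  have h : (z + n - 1 - ((i : ℕ) : ℂ) / ((1 : ℝ) : ℂ)) = z + ((Fin.rev i : ℕ) : ℂ) := by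
    rw [Fin.val_rev, Nat.cast_sub (by omega)]
    push_cast
    ring
  rw [h]
  simp only [Fin.revPerm_apply, shifted, Fin.rev_rev]
  rw [add_comm (κ i), poch_add]

/-- The normalising constant `∏_{i < n} ∏_s (b_s)_i / ∏_r (a_r)_i`. -/
def normConst {p q : ℕ} (n : ℕ) (a : Fin p → ℂ) (b : Fin q → ℂ) : ℂ :=
  ∏ i ∈ Finset.range n, (∏ s, poch (b s) i) / ∏ r, poch (a r) i

lemma coeff_eq {n p q : ℕ} {a : Fin p → ℂ} {b : Fin q → ℂ}
    (ha : ∀ r, ∀ i : ℕ, i + 1 < n → a r ≠ -(i : ℂ)) (hb : ∀ s, ∀ i : ℕ, b s ≠ -(i : ℂ))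
    {κ : Fin n → ℕ} (hκ : Antitone κ) :
    coeff 1 (fun r => a r + n - 1) (fun s => b s + n - 1) κ =
      normConst n a b * ((∏ i, pfqCoeff a b (shifted κ i)) * diffProd (shifted κ)) := by
  have hA : (∏ r, ∏ i ∈ Finset.range n, poch (a r) i) ≠ 0 := by
    refine Finset.prod_ne_zero_iff.mpr fun r _ => Finset.prod_ne_zero_iff.mpr fun i hi => ?_
    rw [Finset.mem_range] at hi
    -- Here j < i < n, so only j ≤ n - 2 has to be excluded.
    exact poch_ne_zero fun j hj => ha r j (by omega)
  have hB : (∏ s, ∏ i ∈ Finset.range n, poch (b s) i) ≠ 0 :=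
    Finset.prod_ne_zero_iff.mpr fun s _ => Finset.prod_ne_zero_iff.mpr fun i _ =>
      poch_ne_zero fun j _ => hb s j
  have hfac : (∏ i, ((shifted κ i)! : ℂ)) ≠ 0 :=
    Finset.prod_ne_zero_iff.mpr fun i _ => Nat.cast_ne_zero.mpr (Nat.factorial_ne_zero _)
  have hhook := hook_mul_diffProd hκ
  have hh : hook 1 κ ≠ 0 := fun h0 => hfac (by rw [← hhook, h0, zero_mul])
  have hjA : ∏ r, jackPoch 1 (a r + n - 1) κ = (∏ r, ∏ i, poch (a r) (shifted κ i)) /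
      ∏ r, ∏ i ∈ Finset.range n, poch (a r) i := by
    rw [eq_div_iff hA, mul_comm, ← Finset.prod_mul_distrib]
    exact Finset.prod_congr rfl fun r _ => jackPoch_mul_prod (a r) κ
  have hjB : ∏ s, jackPoch 1 (b s + n - 1) κ = (∏ s, ∏ i, poch (b s) (shifted κ i)) /
      ∏ s, ∏ i ∈ Finset.range n, poch (b s) i := by
    rw [eq_div_iff hB, mul_comm, ← Finset.prod_mul_distrib]
    exact Finset.prod_congr rfl fun s _ => jackPoch_mul_prod (b s) κ
  have hN : normConst n a b = (∏ s, ∏ i ∈ Finset.range n, poch (b s) i) /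
      ∏ r, ∏ i ∈ Finset.range n, poch (a r) i := by
    rw [normConst, Finset.prod_div_distrib, Finset.prod_comm, Finset.prod_comm (t := Finset.univ)]
  have hP : ∏ i, pfqCoeff a b (shifted κ i) = (∏ r, ∏ i, poch (a r) (shifted κ i)) /
      (∏ s, ∏ i, poch (b s) (shifted κ i)) / ∏ i, ((shifted κ i)! : ℂ) := by
    simp only [pfqCoeff, Finset.prod_div_distrib]
    rw [Finset.prod_comm, Finset.prod_comm (t := (Finset.univ : Finset (Fin q)))]
  have hB' : (∏ s, ∏ i, poch (b s) (shifted κ i)) ≠ 0 :=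
    Finset.prod_ne_zero_iff.mpr fun s _ => Finset.prod_ne_zero_iff.mpr fun i _ =>
      poch_ne_zero fun j _ => hb s j
  have hd : diffProd (shifted κ) ≠ 0 := diffProd_ne_zero (shifted_strictMono hκ).injective
  rw [coeff, hjA, hjB, hN, hP, ← hhook]
  field_simp

lemma eval_jack {n : ℕ} {κ : Fin n → ℕ} (hκ : Antitone κ) {x : Fin n → ℂ}
    (hx : Function.Injective x) :
    eval x (jack 1 κ) = (Matrix.of fun j k : Fin n => x j ^ shifted κ k).det /
      (Matrix.of fun j k : Fin n => x j ^ (k : ℕ)).det := by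
  have h := eval_vandermondePoly_ne_zero hx
  rw [← eval_alternant, ← eval_vandermondePoly, eq_div_iff h, mul_comm, ← map_mul,
    vandermondePoly_mul_jack hκ]

lemma det_pfqCoeff_mul_pow {n p q : ℕ} (a : Fin p → ℂ) (b : Fin q → ℂ) (x : Fin n → ℂ)
    (e : Fin n → ℕ) :
    (Matrix.of fun j i : Fin n => pfqCoeff a b (e i) * x j ^ e i).det =
      (∏ i, pfqCoeff a b (e i)) * (Matrix.of fun j i : Fin n => x j ^ e i).det :=
  Matrix.det_mul_row (fun i => pfqCoeff a b (e i)) (Matrix.of fun j i : Fin n => x j ^ e i)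

/-- The falling factorial of order l is a monic polynomial of degree l, so this determinant equals
the Vandermonde determinant of the e_i. -/
lemma det_descFactorial {n : ℕ} (e : Fin n → ℕ) :
    (Matrix.of fun i l : Fin n => ((e i).descFactorial l : ℂ)).det = diffProd e := by
  have h := Matrix.det_eval_matrixOfPolynomials_eq_det_vandermonde (fun i => (e i : ℂ))
    (fun l : Fin n => descPochhammer ℂ l) (fun l => descPochhammer_natDegree ℂ l)
    (fun l => monic_descPochhammer ℂ l)
  rw [Matrix.det_vandermonde] at h
  rw [diffProd, h]
  congr 1
  ext i l
  simp [descPochhammer_eval_eq_descFactorial]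

lemma term₁_eq {n p q : ℕ} {a : Fin p → ℂ} {b : Fin q → ℂ}
    (ha : ∀ r, ∀ i : ℕ, i + 1 < n → a r ≠ -(i : ℂ)) (hb : ∀ s, ∀ i : ℕ, b s ≠ -(i : ℂ))
    {x : Fin n → ℂ} (hx : Function.Injective x) {κ : Fin n → ℕ} (hκ : Antitone κ) :
    term₁ 1 (fun r => a r + n - 1) (fun s => b s + n - 1) x κ =
      normConst n a b / (Matrix.of fun j k : Fin n => x j ^ (k : ℕ)).det *
        ((Matrix.of fun j i : Fin n =>
            pfqCoeff a b (shifted κ i) * x j ^ shifted κ i).det *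
          (Matrix.of fun i l : Fin n => ((shifted κ i).descFactorial l : ℂ)).det) := by
  rw [term₁, coeff_eq ha hb hκ, eval_jack hκ hx, det_pfqCoeff_mul_pow, det_descFactorial]
  ring

lemma term₂_eq {n p q : ℕ} {a : Fin p → ℂ} {b : Fin q → ℂ}
    (ha : ∀ r, ∀ i : ℕ, i + 1 < n → a r ≠ -(i : ℂ)) (hb : ∀ s, ∀ i : ℕ, b s ≠ -(i : ℂ))
    {x y : Fin n → ℂ} (hx : Function.Injective x) (hy : Function.Injective y)
    {κ : Fin n → ℕ} (hκ : Antitone κ) :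
    term₂ 1 (fun r => a r + n - 1) (fun s => b s + n - 1) x y κ =
      (∏ i ∈ Finset.range n, (i ! : ℂ)) * normConst n a b /
          ((Matrix.of fun j k : Fin n => x j ^ (k : ℕ)).det *
            (Matrix.of fun j k : Fin n => y j ^ (k : ℕ)).det) *
        ((Matrix.of fun j i : Fin n =>
            pfqCoeff a b (shifted κ i) * x j ^ shifted κ i).det *
          (Matrix.of fun i l : Fin n => y l ^ shifted κ i).det) := by
  have h1 := diffProd_mul_eval_one_jack hκ
  have hd : diffProd (shifted κ) ≠ 0 := diffProd_ne_zero (shifted_strictMono hκ).injective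
  have h2 : eval (fun _ => 1) (jack 1 κ) ≠ 0 := fun h0 => hd (by rw [← h1, h0, mul_zero])
  have ht : (Matrix.of fun i l : Fin n => y l ^ shifted κ i).det =
      (Matrix.of fun j k : Fin n => y j ^ shifted κ k).det :=
    (Matrix.det_transpose _).symm
  -- Dividing by P_κ(1,…,1) cancels the difference product and leaves ∏ i!.
  rw [term₂, coeff_eq ha hb hκ, eval_jack hκ hx, eval_jack hκ hy, det_pfqCoeff_mul_pow, ht,
    ← diffProd_val, ← h1]
  field_simp

/-- Absolute convergence permits grouping by weight. -/
lemma tsum_partitions {n : ℕ} (F : (Fin n → ℕ) → ℂ)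
    (hF : Summable fun κ : {κ : Fin n → ℕ // Antitone κ} => ‖F κ.1‖) :
    ∑' k : ℕ, ∑ κ ∈ partitions n k, F κ = ∑' κ : {κ : Fin n → ℕ // Antitone κ}, F κ.1 := by
  set w : {κ : Fin n → ℕ // Antitone κ} → ℕ := fun κ => ∑ i, κ.1 i with hw
  have hmem : ∀ k (κ : Fin n → ℕ), κ ∈ partitions n k ↔ Antitone κ ∧ ∑ i, κ i = k := by
    intro k κ
    simp [partitions, Finset.mem_filter, Finset.mem_piAntidiag, and_comm]
  rw [← (Equiv.sigmaFiberEquiv w).tsum_eq, Summable.tsum_sigma]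
  · refine tsum_congr fun k => ?_
    rw [← Finset.tsum_subtype]
    let E : {κ // κ ∈ partitions n k} ≃ {κ : {κ : Fin n → ℕ // Antitone κ} // w κ = k} :=
      { toFun := fun κ => ⟨⟨κ.1, ((hmem k κ.1).mp κ.2).1⟩, ((hmem k κ.1).mp κ.2).2⟩
        invFun := fun κ => ⟨κ.1.1, (hmem k κ.1.1).mpr ⟨κ.1.2, κ.2⟩⟩
        left_inv := fun _ => rfl
        right_inv := fun _ => rfl }
    rw [← E.tsum_eq]
    rfl
  · exact (Equiv.sigmaFiberEquiv w).summable_iff.mpr hF.of_norm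

/-- Summation over partitions of terms proportional to products of two determinants. -/
lemma summable_and_tsum_of_det {n : ℕ} (u v : Fin n → ℕ → ℂ)
    (huv : ∀ j l, Summable fun k => ‖u j k * v l k‖) (F : (Fin n → ℕ) → ℂ) (N : ℂ)
    (hF : ∀ κ, Antitone κ → F κ = N * ((Matrix.of fun j i : Fin n => u j (shifted κ i)).det *
      (Matrix.of fun i l : Fin n => v l (shifted κ i)).det)) :
    (Summable fun κ : {κ : Fin n → ℕ // Antitone κ} => ‖F κ.1‖) ∧
      ∑' k : ℕ, ∑ κ ∈ partitions n k, F κ =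
        N * (Matrix.of fun j l : Fin n => ∑' k, u j k * v l k).det := by
  obtain ⟨h1, h2⟩ := summable_and_det_tsum_eq_tsum_strictMono u v huv
  have hs : Summable fun κ : {κ : Fin n → ℕ // Antitone κ} => ‖F κ.1‖ := by
    refine (((shiftedEquiv n).summable_iff.mpr h1).mul_left ‖N‖).congr fun κ => ?_
    rw [hF κ.1 κ.2, norm_mul]
    rfl
  refine ⟨hs, ?_⟩
  rw [tsum_partitions F hs, h2, ← (shiftedEquiv n).tsum_eq, ← tsum_mul_left]
  exact tsum_congr fun κ => hF κ.1 κ.2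

end JackHyp

end

/-! ### The two closed forms. -/

theorem mainTheorem12 (n p q : ℕ) (a : Fin p → ℂ) (b : Fin q → ℂ)
    (ha : ∀ r, ∀ i : ℕ, i + 1 < n → a r ≠ -(i : ℂ))
    (hb : ∀ s, ∀ i : ℕ, b s ≠ -(i : ℂ)) :
    (∀ x y : Fin n → ℂ, Function.Injective x → Function.Injective y →
      (p ≤ q ∨ (p = q + 1 ∧ ∀ j k, ‖x j * y k‖ < 1) ∨ (∃ r, ∃ m : ℕ, a r = -(m : ℂ))) →
      Summable (fun κ : {κ : Fin n → ℕ // Antitone κ} =>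
        ‖JackHyp.term₂ 1 (fun r => a r + n - 1) (fun s => b s + n - 1) x y κ.1‖) ∧
      JackHyp.hyp₂ 1 (fun r => a r + n - 1) (fun s => b s + n - 1) x y =
        (∏ i ∈ Finset.range n, ((i.factorial : ℂ) * ∏ s, JackHyp.poch (b s) i) /
            ∏ r, JackHyp.poch (a r) i) *
          ((Matrix.of fun j k : Fin n => JackHyp.pfq a b (x j * y k)).det /
            ((Matrix.of fun j k : Fin n => x j ^ (k : ℕ)).det *
              (Matrix.of fun j k : Fin n => y j ^ (k : ℕ)).det))) ∧
    (∀ x : Fin n → ℂ, Function.Injective x →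
      (p ≤ q ∨ (p = q + 1 ∧ ∀ j, ‖x j‖ < 1) ∨ (∃ r, ∃ m : ℕ, a r = -(m : ℂ))) →
      Summable (fun κ : {κ : Fin n → ℕ // Antitone κ} =>
        ‖JackHyp.term₁ 1 (fun r => a r + n - 1) (fun s => b s + n - 1) x κ.1‖) ∧
      JackHyp.hyp₁ 1 (fun r => a r + n - 1) (fun s => b s + n - 1) x =
        (∏ i ∈ Finset.range n, (∏ s, JackHyp.poch (b s) i) / ∏ r, JackHyp.poch (a r) i) *
          ((Matrix.of fun j k : Fin n =>
              x j ^ (k : ℕ) * iteratedDeriv (k : ℕ) (JackHyp.pfq a b) (x j)).det /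
            (Matrix.of fun j k : Fin n => x j ^ (k : ℕ)).det)) := by
  constructor
  · intro x y hx hy hconv
    have huv : ∀ j l : Fin n,
        Summable fun k => ‖JackHyp.pfqCoeff a b k * x j ^ k * y l ^ k‖ := by
      intro j l
      obtain ⟨R, hR, h⟩ := JackHyp.exists_radius_summable_pfqCoeff a b ‖x j * y l‖
        (hconv.imp_right (Or.imp_left fun h => ⟨h.1, h.2 j l⟩))
      refine (h ‖x j * y l‖ (norm_nonneg _) hR 0).congr fun k => ?_
      rw [pow_zero, mul_one, ← norm_pow, ← norm_mul, mul_pow, mul_assoc]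
    -- Here u_j(k) = c_k x_j^k and v_l(k) = y_l^k.
    obtain ⟨h1, h2⟩ := JackHyp.summable_and_tsum_of_det _ _ huv _ _
      (fun κ hκ => JackHyp.term₂_eq ha hb hx hy hκ)
    refine ⟨h1, ?_⟩
    rw [JackHyp.hyp₂, h2]
    have hp : ∀ j l : Fin n, ∑' k, JackHyp.pfqCoeff a b k * x j ^ k * y l ^ k =
        JackHyp.pfq a b (x j * y l) := by
      intro j l
      rw [JackHyp.pfq_eq_tsum]
      exact tsum_congr fun k => by rw [mul_pow, mul_assoc]
    simp only [hp, JackHyp.normConst, mul_div_assoc, Finset.prod_mul_distrib]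
    ring
  · intro x hx hconv
    have hR : ∀ j : Fin n, ∃ R, ‖x j‖ < R ∧ ∀ r, 0 ≤ r → r < R → ∀ l : ℕ,
        Summable fun k : ℕ => ‖JackHyp.pfqCoeff a b k‖ * ((k : ℝ) + 1) ^ l * r ^ k :=
      fun j => JackHyp.exists_radius_summable_pfqCoeff a b ‖x j‖
        (hconv.imp_right (Or.imp_left fun h => ⟨h.1, h.2 j⟩))
    have huv : ∀ j l : Fin n,
        Summable fun k => ‖JackHyp.pfqCoeff a b k * x j ^ k * (k.descFactorial l : ℂ)‖ := by
      intro j l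
      obtain ⟨R, hxR, h⟩ := hR j
      refine Summable.of_nonneg_of_le (fun _ => norm_nonneg _) (fun k => ?_)
        (h ‖x j‖ (norm_nonneg _) hxR l)
      rw [norm_mul, norm_mul, norm_pow, Complex.norm_natCast, mul_right_comm]
      have hle : (k.descFactorial l : ℝ) ≤ ((k : ℝ) + 1) ^ (l : ℕ) := by
        exact_mod_cast (Nat.descFactorial_le_pow k l).trans
          (Nat.pow_le_pow_left (Nat.le_succ k) l)
      gcongr
    -- Here v_l(k) is the falling factorial of k of order l, so the entries of the determinant are
    -- x^l times l-th derivatives.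
    obtain ⟨h1, h2⟩ := JackHyp.summable_and_tsum_of_det _ _ huv _ _
      (fun κ hκ => JackHyp.term₁_eq ha hb hx hκ)
    refine ⟨h1, ?_⟩
    rw [JackHyp.hyp₁, h2]
    have hp : ∀ j l : Fin n, ∑' k, JackHyp.pfqCoeff a b k * x j ^ k * (k.descFactorial l : ℂ) =
        x j ^ (l : ℕ) * iteratedDeriv (l : ℕ) (JackHyp.pfq a b) (x j) := by
      intro j l
      obtain ⟨R, hxR, h⟩ := hR j
      exact (JackHyp.pow_mul_iteratedDeriv_pfq a b h l hxR).symm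
    simp only [hp, JackHyp.normConst]
    ring
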